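/- For $n\in\mathbb N$ let $V=[n]$, let $\mathcal F=\binom{V}{2}$, and regard a graph $G$ on $V$ as a subset of $\mathcal F$, so that the binomial random graph $G(n,p)$ with $p=p(n)\in[0,1]$ is a probability measure on $2^{\mathcal F}$. For $U\subseteq V$ let $\mathcal F(U)=\{e\in\mathcal F: e\cap U\neq\varnothing\}$. A random variable $Y:2^{\mathcal F}\to\mathbb R$ is *semi-induced with respect to $U$* if $Y(G_1)=Y(G_2)$ whenever $G_1\cap\mathcal F(U)=G_2\cap\mathcal F(U)$. All asymptotics are as $n\to\infty$. **(a)** Let $K>0$ and $t>0$ be constants (independent of $n$). For each $n$ let $\mathcal U=\mathcal U(n)\subseteq 2^V$ be such that $|U|\le t$ for all $U\in\mathcal U$, and for each $U\in\mathcal U$ let $Y_U$ be a random variable that is semi-induced with respect to $U$ and such that for all $G\in 2^{\mathcal F}$ and all $e\in\mathcal F$ with $|e\cap U|=1$, $$0\le Y_U(G)\le Y_U(G\setminus\{e\})\le K\cdot\mathbf 1_{\{G[U]\text{ is connected}\}}.$$ Let $Y=\sum_{U\in\mathcal U}Y_U$ and $\sigma_Y=\mathrm{Var}(Y)^{1/2}$.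 If $p=\Theta(1/n)$ and $\sigma_Y=\omega(n^{1/3})$, then $$\frac{Y-\mathbb E[Y]}{\sigma_Y}\ \xrightarrow{\ d\ }\ \mathcal N(0,1).$$ **(b)** Let $c>1$, $p=c/n$ (for $n$ sufficiently large), $G\sim G(n,p)$, and fix $k\in\mathbb N$. A rooted graph is a pair $(H,r)$ of a finite graph $H$ and a vertex $r$ of $H$; isomorphisms of rooted graphs map root to root. Let $\mathcal H$ be the set of rooted graphs $(H,r)$, up to isomorphism, in which every vertex has distance at most $k$ from $r$, and let $\mathcal T\subseteq\mathcal H$ be the set of those $(T,r)\in\mathcal H$ for which $T$ is a tree with at least $1$ and at most $(10ck)^{2k}$ vertices. Let $\beta_{(H,r)}\in[0,1]$, $(H,r)\in\mathcal H$, be constants (independent of $n$), let $B_G(v,k)$ be the set of vertices at distance at most $k$ from $v$ in $G$, and let $$\widehat M_k=\sum_{v\in V}\ \sum_{(T,r)\in\mathcal T}\beta_{(T,r)}\,\mathbf 1_{\{(G[B_G(v,k)],v)\cong(T,r)\}},$$ the truncation of the weighted $k$-th neighbourhood sum $\sum_{v\in V}\sum_{(H,r)\in\mathcal H}\beta_{(H,r)}\mathbf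 1_{\{(G[B_G(v,k)],v)\cong(H,r)\}}$. If $\mathrm{Var}(\widehat M_k)=\omega(n^{2/3})$, then $$\frac{\widehat M_k-\mathbb E[\widehat M_k]}{\mathrm{Var}(\widehat M_k)^{1/2}}\ \xrightarrow{\ d\ }\ \mathcal N(0,1).$$ -/

import Mathlib

open MeasureTheory ProbabilityTheory Filter Asymptotics
open scoped Topology

/-- The family `Y` of graph parameters, evaluated at `G ∼ G(n, p n)`, satisfies a central limit
theorem: `(Y - 𝔼 Y) / √Var(Y)` converges in distribution to `𝒩(0, 1)` as `n → ∞`. -/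
def SatisfiesCLT (p : ℕ → unitInterval) (Y : (n : ℕ) → SimpleGraph (Fin n) → ℝ) : Prop :=
  TendstoInDistribution
    (fun (n : ℕ) (G : SimpleGraph (Fin n)) =>
      (Y n G - ∫ H, Y n H ∂(SimpleGraph.binomialRandom (Fin n) (p n))) /
        √(variance (Y n) (SimpleGraph.binomialRandom (Fin n) (p n))))
    atTop (id : ℝ → ℝ) (fun n => SimpleGraph.binomialRandom (Fin n) (p n)) (gaussianReal 0 1)

/-- `ℱ(U)`: the two-element subsets of the vertex set which meet `U`. -/
def edgesMeeting {V : Type*} (U : Finset V) : Set (Sym2 V) :=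
  {e | ¬ e.IsDiag ∧ ∃ x ∈ U, x ∈ e}

/-- `Y` is semi-induced with respect to `U`: its value depends only on the edges meeting `U`. -/
def SemiInduced {V : Type*} (U : Finset V) (Y : SimpleGraph V → ℝ) : Prop :=
  ∀ G₁ G₂ : SimpleGraph V,
    G₁.edgeSet ∩ edgesMeeting U = G₂.edgeSet ∩ edgesMeeting U → Y G₁ = Y G₂

open Classical in
/-- `T_U = K · 𝟙{G[U] is connected}`. -/
noncomputable def connIndicator {V : Type*} (K : ℝ) (U : Finset V) (G : SimpleGraph V) : ℝ :=
  if (G.induce (U : Set V)).Connected then K else 0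

/-- A finite rooted graph. -/
structure RootedGraph : Type 1 where
  /-- the vertex set -/
  V : Type
  finite : Finite V
  /-- the graph -/
  graph : SimpleGraph V
  /-- the root -/
  root : V

namespace RootedGraph

/-- Isomorphism of rooted graphs: a graph isomorphism which maps the root to the root. -/
def Iso (H₁ H₂ : RootedGraph) : Prop :=
  ∃ f : H₁.graph ≃g H₂.graph, f H₁.root = H₂.root

instance setoid : Setoid RootedGraph where
  r := Iso
  iseqv :=
    { refl := fun _ => ⟨RelIso.refl _, rfl⟩
      symm := by
        rintro _ _ ⟨f, hf⟩
        exact ⟨f.symm, by rw [← hf]; exact f.symm_apply_apply _⟩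
      trans := by
        rintro _ _ _ ⟨f, hf⟩ ⟨g, hg⟩
        exact ⟨f.trans g, by rw [← hg, ← hf]; rfl⟩ }

/-- Finite rooted graphs up to isomorphism. -/
def IsoClass : Type 1 := Quotient setoid

/-- The isomorphism class of a rooted graph. -/
def cls (H : RootedGraph) : IsoClass := Quotient.mk setoid H

/-- `(H, r)` has radius at most `k`: every vertex has distance at most `k` from the root. -/
def RadiusLE (k : ℕ) (H : RootedGraph) : Prop :=
  ∀ v : H.V, H.graph.edist H.root v ≤ (k : ℕ∞)

/-- `ℋ`: the rooted graphs of radius at most `k`, up to isomorphism. -/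
def radiusClasses (k : ℕ) : Set IsoClass :=
  cls '' {H | H.RadiusLE k}

/-- `𝒯`: the rooted trees of radius at most `k` with at least one and at most
`t_k = (10 c k) ^ (2 k)` vertices, up to isomorphism. -/
def treeClasses (c : ℝ) (k : ℕ) : Set IsoClass :=
  cls '' {H | H.RadiusLE k ∧ H.graph.IsTree ∧ 1 ≤ Nat.card H.V ∧
    (Nat.card H.V : ℝ) ≤ (10 * c * k) ^ (2 * k)}

end RootedGraph

/-- `B_G(v, k)`: the set of vertices at distance at most `k` from `v` in `G`. -/
def closedNbhd {V : Type*} (G : SimpleGraph V) (v : V) (k : ℕ) : Set V :=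
  {w | G.edist v w ≤ (k : ℕ∞)}

/-- The rooted graph `(G[B_G(v, k)], v)`. -/
def rootedNbhd {V : Type} [Finite V] (G : SimpleGraph V) (v : V) (k : ℕ) : RootedGraph where
  V := closedNbhd G v k
  finite := inferInstance
  graph := G.induce (closedNbhd G v k)
  root := ⟨v, by simp [closedNbhd]⟩

open Classical in
/-- `∑_v ∑_{(H, r) ∈ S} β_{(H, r)} · 𝟙{(G[B_G(v, k)], v) ≅ (H, r)}`, for a set `S` of isomorphism
classes of rooted graphs. For each `v` at most one term of the inner sum is non-zero. -/
noncomputable def nbhdSum (k : ℕ) (S : Set RootedGraph.IsoClass) (β : RootedGraph.IsoClass → ℝ)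
    {V : Type} [Fintype V] (G : SimpleGraph V) : ℝ :=
  ∑ v : V, ∑ᶠ τ ∈ S,
    β τ * (if (rootedNbhd G v k).cls = τ then 1 else 0)

/-- The truncation of the weighted `k`-th neighbourhood sum
`nbhdSum k (RootedGraph.radiusClasses k) β`: only the classes in `𝒯` are kept. -/
noncomputable def truncatedNbhdSum (c : ℝ) (k : ℕ) (β : RootedGraph.IsoClass → ℝ)
    {V : Type} [Fintype V] (G : SimpleGraph V) : ℝ :=
  nbhdSum k (RootedGraph.treeClasses c k) β G

/-!
The proof is Stein's method in the form of Barbour, Karoński and Ruciński for decomposable sums, run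
on characteristic functions.

Let `F = ∑ Y U` and write `F ∖ A` for `F` evaluated at the graph without the edges which meet `A`.
Then `Y U` is independent of `F ∖ U`. The difference `F - F ∖ U` is the sum of the
`h U S = Y S - Y S ∖ U`, and `(Y U - 𝔼 Y U) h U S` is independent of `F ∖ (U ∪ S)`. Expanding
`exp (i l F)` around `exp (i l (F ∖ U))`, and then around `exp (i l (F ∖ (U ∪ S)))`, gives
`𝔼 (F - 𝔼 F) exp (i l F) = i l Var(F) 𝔼 exp (i l F) + O(l² M)`, where `M` is a sum of third-order
moments of the pieces (`norm_integral_decomposable_sub_le`). After standardization this says that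
the characteristic function `φ` satisfies `φ'(s) = - s φ(s) + O(s² M / σ³)`, so it is within
`|s|³ M / σ³` of `exp (-s² / 2)` (`norm_charFun_sub_le`), and Lévy's continuity theorem applies.

It remains to see that `M = O(n)`, for then `σ = ω(n^(1/3))` suffices. The difference `h U S` is
non-zero only if `S` is connected in the graph with or without the edges meeting `U`, and `S` meets
`U` or is joined to it by an edge; in that case `U ∪ S` can be explored from `U`
(`abs_sub_deleteEdges_le`). Each moment is thus bounded by the probability of a chain: `U` is
connected, `U ∪ S` can be explored from `U`, and `U ∪ S ∪ T` can be explored from `U ∪ S`. The three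
events concern disjoint sets of edges, so they are independent (`integral_exploration_chain`). In
`G(n, p)` with `p = O(1 / n)`, the expected number of sets of bounded size which can be explored from
a given bounded set is bounded (`sum_integral_exploredIndicator_le`), and hence there are `O(n)`
choices of `U` in expectation (`sum_integral_connIndicator_le`).

For the neighbourhood sums, `Y U` is the contribution of the vertices whose ball of radius `k` is
`U`. It depends only on the edges meeting `U`, and it vanishes unless `U` spans a tree.
-/

/-! ### Independence in the binomial random graph -/

instance instDiscreteMeasurableSpaceSimpleGraph {V : Type*} [Finite V] :
    DiscreteMeasurableSpace (SimpleGraph V) := by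
  have : MeasurableSingletonClass (SimpleGraph V) := ⟨fun G => by
    have h : ({G} : Set (SimpleGraph V)) = SimpleGraph.edgeSet ⁻¹' {G.edgeSet} := by
      ext H
      simp
    rw [h]
    exact SimpleGraph.measurable_edgeSet (measurableSet_singleton _)⟩
  infer_instance

/-- The laws of the edge indicators of `G(V, p)`. -/
noncomputable def edgeLaw (V : Type*) (p : unitInterval) (e : Sym2 V) : Measure Prop :=
  unitInterval.toNNReal p • Measure.dirac (e ∈ (Sym2.diagSetᶜ : Set (Sym2 V))) +
    unitInterval.toNNReal (unitInterval.symm p) • Measure.dirac False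

instance (V : Type*) (p : unitInterval) (e : Sym2 V) : IsProbabilityMeasure (edgeLaw V p e) := by
  unfold edgeLaw
  infer_instance

theorem binomialRandom_eq_map_edgeLaw (V : Type*) [Finite V] (p : unitInterval) :
    SimpleGraph.binomialRandom V p = (Measure.infinitePi (edgeLaw V p)).map
      (fun ω => SimpleGraph.fromEdgeSet {e | ω e}) := by
  rw [SimpleGraph.binomialRandom_eq_map, setBernoulli_eq_map, Measure.map_map
    SimpleGraph.measurable_fromEdgeSet .of_discrete]
  rfl

theorem binomialRandom_real_mem_edgeSet_le {V : Type*} [Finite V] (p : unitInterval) (e : Sym2 V) :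
    (SimpleGraph.binomialRandom V p).real {G | e ∈ G.edgeSet} ≤ p := by
  have hm : Measurable (fun ω : Sym2 V → Prop => SimpleGraph.fromEdgeSet {e | ω e}) :=
    .of_discrete
  have h1 : (Measure.infinitePi (edgeLaw V p)).map (fun ω => ω e) = edgeLaw V p e :=
    Measure.infinitePi_map_eval _ e
  rw [binomialRandom_eq_map_edgeLaw, map_measureReal_apply hm .of_discrete]
  calc _ ≤ (Measure.infinitePi (edgeLaw V p)).real ((fun ω => ω e) ⁻¹' {True}) := by
        refine measureReal_mono ?_
        intro ω
        simp +contextual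
    _ = (edgeLaw V p e).real {True} := by
        rw [← h1, map_measureReal_apply (measurable_pi_apply e) .of_discrete]
    _ ≤ p := by
        simp only [edgeLaw, measureReal_def]
        by_cases he : e.IsDiag <;> simp [he]
        exact p.2.1

/-- `f G` is determined by which edges of the set `A` belong to `G`. -/
def DependsOnEdges {V β : Type*} (A : Set (Sym2 V)) (f : SimpleGraph V → β) : Prop :=
  ∀ G₁ G₂ : SimpleGraph V, G₁.edgeSet ∩ A = G₂.edgeSet ∩ A → f G₁ = f G₂

namespace DependsOnEdges

variable {V β γ δ : Type*} {A B : Set (Sym2 V)} {f : SimpleGraph V → β} {g : SimpleGraph V → γ}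

theorem mono (hf : DependsOnEdges A f) (h : A ⊆ B) : DependsOnEdges B f := by
  intro G₁ G₂ hG
  refine hf _ _ ?_
  ext e
  have := Set.ext_iff.1 hG e
  grind

theorem comp (hf : DependsOnEdges A f) (φ : β → γ) : DependsOnEdges A (fun G => φ (f G)) :=
  fun G₁ G₂ h => congrArg φ (hf G₁ G₂ h)

theorem map₂ (hf : DependsOnEdges A f) (hg : DependsOnEdges A g) (φ : β → γ → δ) :
    DependsOnEdges A (fun G => φ (f G) (g G)) :=
  fun G₁ G₂ h => by simp only [hf G₁ G₂ h, hg G₁ G₂ h]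

theorem sum {ι R : Type*} [AddCommMonoid R] {s : Finset ι} {f : ι → SimpleGraph V → R}
    (hf : ∀ i ∈ s, DependsOnEdges A (f i)) : DependsOnEdges A (fun G => ∑ i ∈ s, f i G) :=
  fun G₁ G₂ h => Finset.sum_congr rfl fun i hi => hf i hi G₁ G₂ h

/-- A function of the edges in `A` factors through the restriction to `A` of the indicator of the
edge set. -/
theorem eq_restrict (hf : DependsOnEdges A f) (S : Finset (Sym2 V)) (hS : A ⊆ S)
    (ω : Sym2 V → Prop) : f (SimpleGraph.fromEdgeSet {e | ω e}) =
      (fun x : S → Prop => f (SimpleGraph.fromEdgeSet {e | ∃ he : e ∈ S, x ⟨e, he⟩}))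
        (fun i => ω i) := by
  apply hf
  ext e
  have := @hS e
  simp at this ⊢
  tauto

/-- Functions of disjoint sets of edges of the binomial random graph are independent. -/
theorem indepFun [Finite V] [MeasurableSpace β] [MeasurableSpace γ] (p : unitInterval)
    (hf : DependsOnEdges A f) (hg : DependsOnEdges B g) (hAB : Disjoint A B) :
    IndepFun f g (SimpleGraph.binomialRandom V p) := by
  classical
  have := Fintype.ofFinite V
  have hind := iIndepFun_infinitePi (P := edgeLaw V p) (X := fun _ x => x) fun _ => measurable_id
  have key := (hind.indepFun_finset A.toFinset B.toFinset (by simpa using hAB)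
    fun e => measurable_pi_apply e).comp
      (φ := fun x => f (SimpleGraph.fromEdgeSet {e | ∃ he : e ∈ A.toFinset, x ⟨e, he⟩}))
      (ψ := fun x => g (SimpleGraph.fromEdgeSet {e | ∃ he : e ∈ B.toFinset, x ⟨e, he⟩}))
      .of_discrete .of_discrete
  have hm : Measurable (fun ω : Sym2 V → Prop => SimpleGraph.fromEdgeSet {e | ω e}) :=
    .of_discrete
  rw [IndepFun_iff]
  rintro _ _ ⟨s, hs, rfl⟩ ⟨t, ht, rfl⟩
  have hst := key.measure_inter_preimage_eq_mul _ _ hs ht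
  rw [binomialRandom_eq_map_edgeLaw, Measure.map_apply hm .of_discrete,
    Measure.map_apply hm .of_discrete, Measure.map_apply hm .of_discrete]
  convert hst using 2
  · ext ω
    simp only [Set.mem_preimage, Set.mem_inter_iff, Function.comp_apply]
    rw [hf.eq_restrict A.toFinset (by simp), hg.eq_restrict B.toFinset (by simp)]
  · congr 1
    ext ω
    simp only [Set.mem_preimage, Function.comp_apply]
    rw [hf.eq_restrict A.toFinset (by simp)]
  · congr 1
    ext ω
    simp only [Set.mem_preimage, Function.comp_apply]
    rw [hg.eq_restrict B.toFinset (by simp)]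

theorem integral_mul [Finite V] {𝕜 : Type*} [RCLike 𝕜] {f g : SimpleGraph V → 𝕜}
    (p : unitInterval)
    (hf : DependsOnEdges A f) (hg : DependsOnEdges B g) (hAB : Disjoint A B) :
    ∫ G, f G * g G ∂(SimpleGraph.binomialRandom V p) =
      (∫ G, f G ∂(SimpleGraph.binomialRandom V p)) * ∫ G, g G ∂(SimpleGraph.binomialRandom V p) :=
  (hf.indepFun p hg hAB).integral_fun_mul_eq_mul_integral
    (Measurable.of_discrete.aestronglyMeasurable) (Measurable.of_discrete.aestronglyMeasurable)

end DependsOnEdges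

/-! ### Exploration of sparse random graphs -/

/-- The pairs contained in `A`. -/
def edgesInside {V : Type*} (A : Finset V) : Set (Sym2 V) := {e | ∀ x ∈ e, x ∈ A}

/-- In `G`, the set `A ∪ S` can be explored from `A`: every proper subset of `A ∪ S` containing `A`
has an edge to the rest of `A ∪ S`. Equivalently, `A ∪ S` becomes connected once `A` is
contracted to a point (for `A ≠ ∅`). -/
def ExploredFrom {V : Type*} [DecidableEq V] (G : SimpleGraph V) (A S : Finset V) : Prop :=
  ∀ B : Finset V, A ⊆ B → B ⊂ A ∪ S → ∃ x ∈ B, ∃ y ∈ S \ B, G.Adj x y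

open Classical in
/-- The indicator of `ExploredFrom`. -/
noncomputable def exploredIndicator {V : Type*} [DecidableEq V] (A S : Finset V) (G : SimpleGraph V) : ℝ :=
  if ExploredFrom G A S then 1 else 0

section

variable {V : Type*}

variable [DecidableEq V]

theorem ExploredFrom.indicator_eq {G : SimpleGraph V} {A S : Finset V} (h : ExploredFrom G A S) :
    exploredIndicator A S G = 1 := if_pos h

theorem exploredIndicator_eq_zero {G : SimpleGraph V} {A S : Finset V}
    (h : ¬ ExploredFrom G A S) : exploredIndicator A S G = 0 := if_neg h

theorem exploredIndicator_nonneg (A S : Finset V) (G : SimpleGraph V) :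
    0 ≤ exploredIndicator A S G := by
  unfold exploredIndicator
  split_ifs <;> simp

theorem exploredIndicator_le_one (A S : Finset V) (G : SimpleGraph V) :
    exploredIndicator A S G ≤ 1 := by
  unfold exploredIndicator
  split_ifs <;> simp

theorem ExploredFrom.mono_left {G : SimpleGraph V} {A A' S : Finset V} (hA : A ⊆ A')
    (h : ExploredFrom G A S) : ExploredFrom G A' S := by
  intro B hB hBS
  obtain ⟨x, hx, y, hy, hxy⟩ := h (B ∩ (A ∪ S)) (by grind) ⟨Finset.inter_subset_right, fun hc =>
    hBS.2 (Finset.union_subset hB fun z hz => (Finset.mem_inter.1 (hc (by simp [hz]))).1)⟩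
  exact ⟨x, by grind, y, by grind, hxy⟩

theorem exploredIndicator_mono_left {A A' : Finset V} (hA : A ⊆ A') (S : Finset V)
    (G : SimpleGraph V) : exploredIndicator A S G ≤ exploredIndicator A' S G := by
  by_cases h : ExploredFrom G A S
  · rw [h.indicator_eq, (h.mono_left hA).indicator_eq]
  · rw [exploredIndicator_eq_zero h]
    exact exploredIndicator_nonneg A' S G

theorem ExploredFrom.congr {G₁ G₂ : SimpleGraph V} {A S : Finset V}
    (h : G₁.edgeSet ∩ (edgesInside (A ∪ S) \ edgesInside A) =
      G₂.edgeSet ∩ (edgesInside (A ∪ S) \ edgesInside A))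
    (h₁ : ExploredFrom G₁ A S) : ExploredFrom G₂ A S := by
  intro B hB hBS
  obtain ⟨x, hx, y, hy, hxy⟩ := h₁ B hB hBS
  refine ⟨x, hx, y, hy, ?_⟩
  have := Set.ext_iff.1 h s(x, y)
  have hx' := hBS.1 hx
  simp only [edgesInside, Set.mem_inter_iff, SimpleGraph.mem_edgeSet, Set.mem_sdiff, Set.mem_ofPred_eq,
    Sym2.mem_iff] at this
  grind

theorem dependsOnEdges_exploredIndicator (A S : Finset V) :
    DependsOnEdges (edgesInside (A ∪ S) \ edgesInside A) (exploredIndicator A S) := by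
  intro G₁ G₂ h
  by_cases h₁ : ExploredFrom G₁ A S
  · rw [h₁.indicator_eq, (h₁.congr h).indicator_eq]
  · rw [exploredIndicator_eq_zero h₁, exploredIndicator_eq_zero fun h₂ => h₁ (h₂.congr h.symm)]

theorem connIndicator_nonneg {K : ℝ} (hK : 0 ≤ K) (U : Finset V) (G : SimpleGraph V) :
    0 ≤ connIndicator K U G := by
  unfold connIndicator
  split_ifs <;> simp [hK]

theorem connIndicator_eq_mul (K : ℝ) (U : Finset V) (G : SimpleGraph V) :
    connIndicator K U G = K * connIndicator 1 U G := by
  unfold connIndicator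
  split_ifs <;> simp

theorem dependsOnEdges_connIndicator (K : ℝ) (U : Finset V) :
    DependsOnEdges (edgesInside U) (connIndicator K U) := by
  intro G₁ G₂ h
  have : G₁.induce (U : Set V) = G₂.induce (U : Set V) := by
    ext x y
    have := Set.ext_iff.1 h s(x, y)
    simpa [edgesInside] using this
  unfold connIndicator
  by_cases hc : (G₁.induce (U : Set V)).Connected
  · rw [if_pos hc, if_pos (this ▸ hc)]
  · rw [if_neg hc, if_neg (this ▸ hc)]

/-- A connected set which meets `A` or is joined to it by an edge can be explored from `A`. -/
theorem exploredFrom_of_connected {G : SimpleGraph V} {A S : Finset V}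
    (hS : (G.induce (S : Set V)).Connected)
    (h : ∃ x ∈ A, ∃ y ∈ S, x = y ∨ G.Adj x y) : ExploredFrom G A S := by
  intro B hAB hBS
  by_cases hne : ∃ z ∈ S, z ∈ B
  · obtain ⟨z, hz, hzB⟩ := hne
    obtain ⟨w, hw, hwB⟩ : ∃ w ∈ S, w ∉ B := by
      by_contra! hcon
      exact hBS.2 (Finset.union_subset hAB hcon)
    obtain ⟨p⟩ := hS.preconnected ⟨z, hz⟩ ⟨w, hw⟩
    obtain ⟨d, -, hd₁, hd₂⟩ := p.exists_boundary_dart {x | (x : V) ∈ B} hzB hwB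
    exact ⟨d.fst, hd₁, d.snd, Finset.mem_sdiff.2 ⟨d.snd.2, hd₂⟩, d.adj⟩
  · push Not at hne
    obtain ⟨x, hx, y, hy, hxy⟩ := h
    refine ⟨x, hAB hx, y, by simp [hy, hne y hy], hxy.resolve_left ?_⟩
    rintro rfl
    exact hne x hy (hAB hx)

/-- If `A ∪ S` can be explored from `A`, then `S ⊆ A`, or the exploration can start with a vertex
`v ∈ S \ A` adjacent to `A`. -/
theorem exploredIndicator_le [Fintype V] (A S : Finset V) (G : SimpleGraph V) :
    exploredIndicator A S G ≤ (if S ⊆ A then 1 else 0) +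
      ∑ v, if v ∈ S ∧ v ∉ A then
        (∑ x ∈ A, Set.indicator {G : SimpleGraph V | s(x, v) ∈ G.edgeSet} 1 G) *
          exploredIndicator (insert v A) S G else 0 := by
  have hnn : ∀ v, 0 ≤ (if v ∈ S ∧ v ∉ A then
        (∑ x ∈ A, Set.indicator {G : SimpleGraph V | s(x, v) ∈ G.edgeSet} (1 : SimpleGraph V → ℝ) G) *
          exploredIndicator (insert v A) S G else 0) := by
    intro v
    split_ifs
    · exact mul_nonneg (Finset.sum_nonneg fun x _ => Set.indicator_nonneg (fun _ _ => zero_le_one) _)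
        (exploredIndicator_nonneg _ _ _)
    · exact le_rfl
  by_cases hSA : S ⊆ A
  · rw [if_pos hSA]
    have := Finset.sum_nonneg fun v (_ : v ∈ Finset.univ) => hnn v
    have := exploredIndicator_le_one A S G
    linarith
  rw [if_neg hSA, zero_add]
  by_cases h : ExploredFrom G A S
  · obtain ⟨x, hx, y, hy, hxy⟩ := h A subset_rfl
      ⟨Finset.subset_union_left, fun h' => hSA (Finset.union_subset_iff.1 h').2⟩
    refine (exploredIndicator_mono_left (Finset.subset_insert y A) S G).trans ?_
    refine le_trans ?_ (Finset.single_le_sum (fun v _ => hnn v) (Finset.mem_univ y))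
    rw [if_pos (by simpa using hy)]
    refine le_mul_of_one_le_left (exploredIndicator_nonneg _ _ _) ?_
    refine le_trans ?_ (Finset.single_le_sum (f := fun x => Set.indicator
      {G : SimpleGraph V | s(x, y) ∈ G.edgeSet} (1 : SimpleGraph V → ℝ) G)
      (fun v _ => Set.indicator_nonneg (fun _ _ => zero_le_one) _) hx)
    simp [hxy]
  · rw [exploredIndicator_eq_zero h]
    exact Finset.sum_nonneg fun v _ => hnn v

/-- The bound on the expected number of sets `S` with `|S \ A| ≤ m`, where `|A| ≤ a`, which can be
explored from `A` when the average degree is at most `C`. -/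
def explorationBound (C : ℝ) : ℕ → ℕ → ℝ
  | 0, a => 2 ^ a
  | m + 1, a => 2 ^ a + C * (a * explorationBound C m (a + 1))

theorem explorationBound_nonneg {C : ℝ} (hC : 0 ≤ C) (m a : ℕ) : 0 ≤ explorationBound C m a := by
  induction m generalizing a with
  | zero => simp [explorationBound]
  | succ m ih =>
    have := ih (a + 1)
    simp only [explorationBound]
    positivity

theorem integral_sum_edgeIndicator_le [Fintype V] (p : unitInterval) (A : Finset V) (v : V) :
    ∫ G, ∑ x ∈ A, Set.indicator {G : SimpleGraph V | s(x, v) ∈ G.edgeSet} (1 : SimpleGraph V → ℝ) G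
      ∂(SimpleGraph.binomialRandom V p) ≤ A.card * p := by
  rw [integral_finsetSum _ fun _ _ => .of_finite, ← nsmul_eq_mul]
  refine Finset.sum_le_card_nsmul _ _ _ fun x _ => ?_
  rw [integral_indicator_one .of_discrete]
  exact binomialRandom_real_mem_edgeSet_le p _

/-- The expected number of small sets which can be explored from `A` is bounded: each exploration
step has at most `|V|` choices of a new vertex, which is adjacent to the explored set with
probability `O(p)`, independently of the later steps. -/
theorem sum_integral_exploredIndicator_le [Fintype V] {p : unitInterval} {C : ℝ}
    (hC : Fintype.card V * (p : ℝ) ≤ C) (m a : ℕ) (A : Finset V) (hA : A.card ≤ a) :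
    ∑ S : Finset V with (S \ A).card ≤ m,
      ∫ G, exploredIndicator A S G ∂(SimpleGraph.binomialRandom V p) ≤ explorationBound C m a := by
  have hC0 : 0 ≤ C := le_trans (mul_nonneg (Nat.cast_nonneg _) p.2.1) hC
  have hsub : ∑ S : Finset V, (if S ⊆ A then (1 : ℝ) else 0) ≤ 2 ^ a := by
    rw [Finset.sum_boole]
    have : (Finset.univ.filter fun S : Finset V => S ⊆ A) = A.powerset := by
      ext S
      simp
    rw [this, Finset.card_powerset]
    exact_mod_cast Nat.pow_le_pow_right two_pos hA
  induction m generalizing a A with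
  | zero =>
    refine le_trans ?_ hsub
    rw [Finset.sum_filter]
    refine Finset.sum_le_sum fun S _ => ?_
    have h : (S \ A).card ≤ 0 ↔ S ⊆ A := by simp
    simp only [h]
    split_ifs
    · calc _ ≤ ∫ G, (1 : ℝ) ∂(SimpleGraph.binomialRandom V p) :=
          integral_mono .of_finite .of_finite fun G => exploredIndicator_le_one A S G
        _ = 1 := by simp
    · exact le_rfl
  | succ m ih =>
    have hstep : ∀ S : Finset V,
        ∫ G, exploredIndicator A S G ∂(SimpleGraph.binomialRandom V p) ≤
        (if S ⊆ A then 1 else 0) + ∑ v, if v ∈ S ∧ v ∉ A then (a * (p : ℝ)) *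
          ∫ G, exploredIndicator (insert v A) S G ∂(SimpleGraph.binomialRandom V p) else 0 := by
      intro S
      refine (integral_mono .of_finite .of_finite fun G => exploredIndicator_le A S G).trans ?_
      rw [integral_add .of_finite .of_finite, integral_finsetSum _ fun _ _ => .of_finite]
      refine add_le_add (by simp) (Finset.sum_le_sum fun v _ => ?_)
      split_ifs with hv
      · rw [DependsOnEdges.integral_mul (A := edgesInside (insert v A)) p ?_
          (dependsOnEdges_exploredIndicator (insert v A) S) Set.disjoint_sdiff_right]
        · refine mul_le_mul_of_nonneg_right ((integral_sum_edgeIndicator_le p A v).trans ?_)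
            (integral_nonneg fun G => exploredIndicator_nonneg _ _ _)
          exact mul_le_mul_of_nonneg_right (by exact_mod_cast hA) p.2.1
        · refine DependsOnEdges.sum fun x hx G₁ G₂ h => ?_
          have := Set.ext_iff.1 h s(x, v)
          have hi : s(x, v) ∈ edgesInside (insert v A) := by
            simp [edgesInside, hx]
          simp only [Set.mem_inter_iff, hi, and_true] at this
          by_cases hm : s(x, v) ∈ G₁.edgeSet
          · simp only [Set.indicator, Set.mem_ofPred_eq, hm, this.1 hm, if_true, Pi.one_apply]
          · simp only [Set.indicator, Set.mem_ofPred_eq, hm, mt this.2 hm, if_false]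
      · simp
    calc _ ≤ ∑ S : Finset V with (S \ A).card ≤ m + 1,
          ((if S ⊆ A then 1 else 0) + ∑ v, if v ∈ S ∧ v ∉ A then (a * (p : ℝ)) *
          ∫ G, exploredIndicator (insert v A) S G ∂(SimpleGraph.binomialRandom V p) else 0) :=
          Finset.sum_le_sum fun S _ => hstep S
      _ ≤ 2 ^ a + ∑ v : V, (a * (p : ℝ)) * explorationBound C m (a + 1) := by
          rw [Finset.sum_add_distrib]
          refine add_le_add (le_trans (Finset.sum_le_sum_of_subset_of_nonneg
            (Finset.filter_subset _ _) fun S _ _ => by split_ifs <;> simp) hsub) ?_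
          rw [Finset.sum_comm]
          refine Finset.sum_le_sum fun v _ => ?_
          have hp : 0 ≤ (a * (p : ℝ)) := mul_nonneg (Nat.cast_nonneg _) p.2.1
          by_cases hv : v ∈ A
          · simp only [hv, not_true_eq_false, and_false, if_false, Finset.sum_const_zero]
            exact mul_nonneg hp (explorationBound_nonneg hC0 _ _)
          have hcard : (insert v A).card ≤ a + 1 :=
            (Finset.card_insert_le _ _).trans (by omega)
          refine le_trans ?_ (mul_le_mul_of_nonneg_left (ih (a + 1) (insert v A) hcard ?_) hp)
          · rw [Finset.mul_sum, Finset.sum_filter, Finset.sum_filter]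
            refine Finset.sum_le_sum fun S _ => ?_
            have hpos := mul_nonneg hp (integral_nonneg (μ := SimpleGraph.binomialRandom V p)
              fun G => exploredIndicator_nonneg (insert v A) S G)
            by_cases hvS : v ∈ S
            · have : (S \ A).card = (S \ insert v A).card + 1 := by
                rw [Finset.sdiff_insert, Finset.card_erase_add_one (by simp [hvS, hv])]
              simp [hvS, hv, this]
            · simp only [hvS, false_and, if_false, ite_self]
              split_ifs
              · exact hpos
              · exact le_rfl
          · rw [Finset.sum_boole]
            have : (Finset.univ.filter fun S : Finset V => S ⊆ insert v A) =
                (insert v A).powerset := by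
              ext S
              simp
            rw [this, Finset.card_powerset]
            exact_mod_cast Nat.pow_le_pow_right two_pos hcard
      _ = 2 ^ a + (Fintype.card V * p) * (a * explorationBound C m (a + 1)) := by
          simp
          ring
      _ ≤ explorationBound C (m + 1) a := by
          rw [explorationBound]
          have := explorationBound_nonneg hC0 m (a + 1)
          gcongr

/-- The expected number of connected sets of at most `t` vertices is linear in `|V|`. -/
theorem sum_integral_connIndicator_le [Fintype V] {p : unitInterval} {C : ℝ}
    (hC : Fintype.card V * (p : ℝ) ≤ C) (t : ℕ) :
    ∑ S : Finset V with S.card ≤ t,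
      ∫ G, connIndicator 1 S G ∂(SimpleGraph.binomialRandom V p) ≤
        Fintype.card V * explorationBound C t 1 := by
  have h : ∀ S : Finset V, ∫ G, connIndicator 1 S G ∂(SimpleGraph.binomialRandom V p) ≤
      ∑ v, ∫ G, exploredIndicator {v} S G ∂(SimpleGraph.binomialRandom V p) := by
    intro S
    rw [← integral_finsetSum _ fun _ _ => .of_finite]
    refine integral_mono .of_finite .of_finite fun G => ?_
    unfold connIndicator
    split_ifs with hS
    · obtain ⟨v, hv⟩ := hS.nonempty
      refine le_trans ?_ (Finset.single_le_sum
        (fun v _ => exploredIndicator_nonneg {v} S G) (Finset.mem_univ v))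
      have := exploredFrom_of_connected (A := {v}) hS ⟨v, by simp, v, hv, .inl rfl⟩
      exact this.indicator_eq.ge
    · exact Finset.sum_nonneg fun v _ => exploredIndicator_nonneg {v} S G
  refine (Finset.sum_le_sum fun S _ => h S).trans ?_
  rw [Finset.sum_comm, ← nsmul_eq_mul]
  refine Finset.sum_le_card_nsmul _ _ _ fun v _ => ?_
  refine le_trans ?_ (sum_integral_exploredIndicator_le hC t 1 {v} (by simp))
  refine Finset.sum_le_sum_of_subset_of_nonneg (fun S hS => ?_)
    fun S _ _ => integral_nonneg fun G => exploredIndicator_nonneg {v} S G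
  simp only [Finset.mem_filter, Finset.mem_univ, true_and] at hS ⊢
  exact (Finset.card_le_card Finset.sdiff_subset).trans hS

end

/-! ### Characteristic functions close to the Gaussian one -/

theorem norm_cexp_mul_I_sub_le (x y : ℝ) :
    ‖Complex.exp (x * Complex.I) - Complex.exp (y * Complex.I)‖ ≤ |x - y| := by
  have h : Complex.exp (x * Complex.I) - Complex.exp (y * Complex.I) =
      Complex.exp (y * Complex.I) * (Complex.exp (Complex.I * (x - y : ℝ)) - 1) := by
    rw [mul_sub, ← Complex.exp_add]
    push_cast
    ring_nf
  rw [h, norm_mul, Complex.norm_exp_ofReal_mul_I, one_mul]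
  exact Real.norm_exp_I_mul_ofReal_sub_one_le

theorem norm_cexp_mul_I_sub_one_sub_le (x : ℝ) :
    ‖Complex.exp (x * Complex.I) - 1 - x * Complex.I‖ ≤ 2 * x ^ 2 := by
  rcases le_or_gt |x| 1 with h | h
  · have := Complex.norm_exp_sub_one_sub_id_le (x := x * Complex.I) (by simpa using h)
    have h2 : ‖(x * Complex.I : ℂ)‖ ^ 2 = x ^ 2 := by simp
    nlinarith [sq_nonneg x]
  · have h1 := norm_cexp_mul_I_sub_le x 0
    have h2 : ‖(x * Complex.I : ℂ)‖ = |x| := by simp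
    have h3 := norm_sub_le (Complex.exp (x * Complex.I) - 1) (x * Complex.I)
    have h4 : |x| ≤ x ^ 2 := by
      rw [← sq_abs]
      nlinarith
    simp only [Complex.ofReal_zero, zero_mul, Complex.exp_zero, sub_zero] at h1
    linarith

section

variable {Ω : Type*} [MeasurableSpace Ω] {μ : Measure Ω} [IsProbabilityMeasure μ]

/-- If the characteristic function `φ` of `W` nearly satisfies the differential equation
`φ' = - s φ` of the standard Gaussian characteristic function, then it is close to it. -/
theorem norm_charFun_sub_le [Finite Ω] [MeasurableSingletonClass Ω] {W : Ω → ℝ} {δ : ℝ}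
    (hW : ∀ s : ℝ, ‖(∫ ω, (W ω : ℂ) * Complex.exp ((s * W ω : ℝ) * Complex.I) ∂μ) -
      s * Complex.I * ∫ ω, Complex.exp ((s * W ω : ℝ) * Complex.I) ∂μ‖ ≤ δ * s ^ 2) (s : ℝ) :
    ‖charFun (μ.map W) s - Complex.exp (-(s ^ 2 / 2 : ℝ))‖ ≤ δ * |s| ^ 3 := by
  have := Fintype.ofFinite Ω
  set φ : ℝ → ℂ := fun s => ∫ ω, Complex.exp ((s * W ω : ℝ) * Complex.I) ∂μ with hφ
  have hchar : charFun (μ.map W) s = φ s := by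
    rw [charFun_apply_real, integral_map (Measurable.of_discrete).aemeasurable (by fun_prop)]
    simp [hφ]
  have hderiv : ∀ s, HasDerivAt φ
      ((∫ ω, (W ω : ℂ) * Complex.exp ((s * W ω : ℝ) * Complex.I) ∂μ) * Complex.I) s := by
    intro s
    simp only [hφ, integral_fintype .of_finite, Finset.sum_mul]
    refine HasDerivAt.fun_sum fun ω _ => ?_
    have h1 : HasDerivAt (fun s : ℝ => Complex.exp ((s * W ω : ℝ) * Complex.I))
        (Complex.exp ((s * W ω : ℝ) * Complex.I) * (W ω * Complex.I)) s := by
      refine HasDerivAt.cexp ?_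
      have h0 := ((hasDerivAt_id s).mul_const (W ω)).ofReal_comp.mul_const Complex.I
      simpa using h0
    have h2 := h1.const_smul (μ.real {ω})
    convert! h2 using 1
    simp only [Complex.real_smul]
    ring
  set ψ : ℝ → ℂ := fun s => φ s * Complex.exp ((s ^ 2 / 2 : ℝ)) with hψ
  have hψd : ∀ u, HasDerivAt ψ (((∫ ω, (W ω : ℂ) * Complex.exp ((u * W ω : ℝ) * Complex.I) ∂μ)
      - u * Complex.I * φ u) * Complex.I * Complex.exp ((u ^ 2 / 2 : ℝ))) u := by
    intro u
    have h1 : HasDerivAt (fun u : ℝ => Complex.exp ((u ^ 2 / 2 : ℝ)))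
        (Complex.exp ((u ^ 2 / 2 : ℝ)) * u) u := by
      refine HasDerivAt.cexp ?_
      have h0 : HasDerivAt (fun u : ℝ => u ^ 2 / 2) u u := by
        have := (hasDerivAt_pow 2 u).div_const 2
        simpa using this
      exact h0.ofReal_comp
    have h2 := (hderiv u).mul h1
    convert! h2 using 1
    linear_combination (-u * φ u * Complex.exp ((u ^ 2 / 2 : ℝ))) * Complex.I_sq
  have hδ : 0 ≤ δ := by
    have := (norm_nonneg _).trans (hW 1)
    simpa using this
  have hbound : ∀ u ∈ Set.uIcc 0 s, ‖((∫ ω, (W ω : ℂ) * Complex.exp ((u * W ω : ℝ) * Complex.I) ∂μ)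
      - u * Complex.I * φ u) * Complex.I * Complex.exp ((u ^ 2 / 2 : ℝ))‖ ≤
        δ * s ^ 2 * Real.exp (s ^ 2 / 2) := by
    intro u hu
    have hus : u ^ 2 ≤ s ^ 2 := by
      rw [sq_le_sq]
      have := Set.abs_sub_left_of_mem_uIcc hu
      simpa using this
    rw [norm_mul, norm_mul, Complex.norm_I, mul_one, Complex.norm_exp_ofReal]
    refine mul_le_mul ((hW u).trans (by gcongr)) (Real.exp_le_exp.2 (by linarith))
      (Real.exp_pos _).le (by positivity)
  have hmv := (convex_uIcc (0 : ℝ) s).norm_image_sub_le_of_norm_hasDerivWithin_le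
    (fun u _ => (hψd u).hasDerivWithinAt) hbound Set.left_mem_uIcc Set.right_mem_uIcc
  have hψ0 : ψ 0 = 1 := by simp [hψ, hφ]
  have heq : charFun (μ.map W) s - Complex.exp (-(s ^ 2 / 2 : ℝ)) =
      (ψ s - ψ 0) * Complex.exp (-(s ^ 2 / 2 : ℝ)) := by
    rw [hψ0, sub_mul, one_mul, hchar, hψ]
    simp only
    rw [mul_assoc, ← Complex.exp_add, add_neg_cancel, Complex.exp_zero, mul_one]
  rw [heq, norm_mul, ← Complex.ofReal_neg, Complex.norm_exp_ofReal]
  calc _ ≤ (δ * s ^ 2 * Real.exp (s ^ 2 / 2) * ‖s - 0‖) * Real.exp (-(s ^ 2 / 2)) := by gcongr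
    _ = δ * |s| ^ 3 * (Real.exp (s ^ 2 / 2) * Real.exp (-(s ^ 2 / 2))) := by
        rw [sub_zero, Real.norm_eq_abs, ← sq_abs]
        ring
    _ = δ * |s| ^ 3 := by
        rw [← Real.exp_add, add_neg_cancel, Real.exp_zero, mul_one]

end

/-! ### Stein's method for decomposable sums -/

section

variable {Ω : Type*} [MeasurableSpace Ω] {μ : Measure Ω} [Finite Ω] [MeasurableSingletonClass Ω]

theorem ProbabilityTheory.IndepFun.integral_mul_cexp {Z F : Ω → ℝ} (h : IndepFun Z F μ) (l : ℝ) :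
    ∫ ω, (Z ω : ℂ) * Complex.exp ((l * F ω : ℝ) * Complex.I) ∂μ =
      ((∫ ω, Z ω ∂μ : ℝ) : ℂ) * ∫ ω, Complex.exp ((l * F ω : ℝ) * Complex.I) ∂μ := by
  have h1 : IndepFun (fun ω => (Z ω : ℂ)) (fun ω => Complex.exp ((l * F ω : ℝ) * Complex.I)) μ :=
    h.comp (φ := fun x : ℝ => (x : ℂ)) (ψ := fun x : ℝ => Complex.exp ((l * x : ℝ) * Complex.I))
      (by fun_prop) (by fun_prop)
  rw [h1.integral_fun_mul_eq_mul_integral Measurable.of_discrete.aestronglyMeasurable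
    Measurable.of_discrete.aestronglyMeasurable, integral_complex_ofReal]

variable [IsProbabilityMeasure μ]

/-- A variable `Z` independent of `F'` is nearly uncorrelated with `exp (i l F)` if `F'` is close
to `F`. -/
theorem norm_integral_mul_cexp_sub_le {Z F F' : Ω → ℝ} (h : IndepFun Z F' μ) (l : ℝ) :
    ‖(∫ ω, (Z ω : ℂ) * Complex.exp ((l * F ω : ℝ) * Complex.I) ∂μ) -
      ((∫ ω, Z ω ∂μ : ℝ) : ℂ) * ∫ ω, Complex.exp ((l * F ω : ℝ) * Complex.I) ∂μ‖ ≤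
    |l| * ((∫ ω, |Z ω| * |F ω - F' ω| ∂μ) + (∫ ω, |Z ω| ∂μ) * ∫ ω, |F ω - F' ω| ∂μ) := by
  have hd : ∀ ω, ‖Complex.exp ((l * F ω : ℝ) * Complex.I) -
      Complex.exp ((l * F' ω : ℝ) * Complex.I)‖ ≤ |l| * |F ω - F' ω| := fun ω => by
    rw [← abs_mul, mul_sub]
    exact norm_cexp_mul_I_sub_le _ _
  have heq : (∫ ω, (Z ω : ℂ) * Complex.exp ((l * F ω : ℝ) * Complex.I) ∂μ) -
      ((∫ ω, Z ω ∂μ : ℝ) : ℂ) * ∫ ω, Complex.exp ((l * F ω : ℝ) * Complex.I) ∂μ =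
      (∫ ω, (Z ω : ℂ) * (Complex.exp ((l * F ω : ℝ) * Complex.I) -
        Complex.exp ((l * F' ω : ℝ) * Complex.I)) ∂μ) -
      ((∫ ω, Z ω ∂μ : ℝ) : ℂ) * ∫ ω, (Complex.exp ((l * F ω : ℝ) * Complex.I) -
        Complex.exp ((l * F' ω : ℝ) * Complex.I)) ∂μ := by
    simp only [mul_sub]
    rw [integral_sub .of_finite .of_finite, integral_sub .of_finite .of_finite,
      h.integral_mul_cexp l]
    ring
  rw [heq, mul_add]
  refine (norm_sub_le _ _).trans (add_le_add ?_ ?_)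
  · rw [← integral_const_mul]
    refine norm_integral_le_of_norm_le .of_finite (.of_forall fun ω => ?_)
    rw [norm_mul, Complex.norm_real, Real.norm_eq_abs, mul_left_comm]
    exact mul_le_mul_of_nonneg_left (hd ω) (abs_nonneg _)
  · rw [norm_mul, Complex.norm_real, Real.norm_eq_abs, mul_left_comm, ← integral_const_mul]
    refine mul_le_mul abs_integral_le_integral_abs
      (norm_integral_le_of_norm_le .of_finite (.of_forall hd)) (norm_nonneg _)
      (integral_nonneg fun _ => abs_nonneg _)

/-- A centred variable `X` independent of `F'` satisfies
`𝔼 X exp (i l F) ≈ i l 𝔼 X (F - F') exp (i l F)`. -/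
theorem norm_integral_centred_mul_cexp_sub_le {X F F' : Ω → ℝ} (h : IndepFun X F' μ)
    (hX : ∫ ω, X ω ∂μ = 0) (l : ℝ) :
    ‖(∫ ω, (X ω : ℂ) * Complex.exp ((l * F ω : ℝ) * Complex.I) ∂μ) -
      l * Complex.I * ∫ ω, ((X ω * (F ω - F' ω) : ℝ) : ℂ) *
        Complex.exp ((l * F ω : ℝ) * Complex.I) ∂μ‖ ≤
    l ^ 2 * (2 * ∫ ω, |X ω| * (F ω - F' ω) ^ 2 ∂μ) := by
  have h0 : ∫ ω, (X ω : ℂ) * Complex.exp ((l * F' ω : ℝ) * Complex.I) ∂μ = 0 := by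
    rw [h.integral_mul_cexp l, hX]
    simp
  rw [← sub_zero (∫ ω, (X ω : ℂ) * Complex.exp ((l * F ω : ℝ) * Complex.I) ∂μ), ← h0,
    ← integral_const_mul, ← integral_sub .of_finite .of_finite,
    ← integral_sub .of_finite .of_finite, ← integral_const_mul, ← integral_const_mul]
  refine norm_integral_le_of_norm_le .of_finite (.of_forall fun ω => ?_)
  have hexp : Complex.exp ((l * F' ω : ℝ) * Complex.I) =
      Complex.exp ((l * F ω : ℝ) * Complex.I) *
        Complex.exp ((-(l * (F ω - F' ω)) : ℝ) * Complex.I) := by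
    rw [← Complex.exp_add]
    push_cast
    ring_nf
  have heq : (X ω : ℂ) * Complex.exp ((l * F ω : ℝ) * Complex.I) -
      (X ω : ℂ) * Complex.exp ((l * F' ω : ℝ) * Complex.I) -
      l * Complex.I * (((X ω * (F ω - F' ω) : ℝ) : ℂ) *
        Complex.exp ((l * F ω : ℝ) * Complex.I)) =
      -((X ω : ℂ) * Complex.exp ((l * F ω : ℝ) * Complex.I) *
        (Complex.exp ((-(l * (F ω - F' ω)) : ℝ) * Complex.I) - 1 -
          (-(l * (F ω - F' ω)) : ℝ) * Complex.I)) := by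
    rw [hexp]
    push_cast
    ring
  rw [heq, norm_neg, norm_mul, norm_mul, Complex.norm_real, Complex.norm_exp_ofReal_mul_I, mul_one,
    Real.norm_eq_abs]
  calc _ ≤ |X ω| * (2 * (-(l * (F ω - F' ω))) ^ 2) :=
        mul_le_mul_of_nonneg_left (norm_cexp_mul_I_sub_one_sub_le _) (abs_nonneg _)
    _ = _ := by ring

/-- **Stein's identity for decomposable sums.** Let `F = ∑ Y i`, where `Y i` is independent of
`F₁ i`, the difference `F - F₁ i` is a sum of terms `h i j`, and `(Y i - 𝔼 Y i) h i j` is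
independent of `F₂ i j`. Then `𝔼 (F - 𝔼 F) exp (i l F) ≈ i l Var(F) 𝔼 exp (i l F)`, with an error
controlled by third-order moments. -/
theorem norm_integral_decomposable_sub_le {ι : Type*} {s : Finset ι} {Y F₁ : ι → Ω → ℝ}
    {h F₂ : ι → ι → Ω → ℝ} {F : Ω → ℝ} (hF : ∀ ω, F ω = ∑ i ∈ s, Y i ω)
    (hF₁ : ∀ i ∈ s, ∀ ω, F ω - F₁ i ω = ∑ j ∈ s, h i j ω)
    (hind₁ : ∀ i ∈ s, IndepFun (Y i) (F₁ i) μ)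
    (hind₂ : ∀ i ∈ s, ∀ j ∈ s, IndepFun (fun ω => (Y i ω - ∫ η, Y i η ∂μ) * h i j ω) (F₂ i j) μ)
    (l : ℝ) :
    ‖(∫ ω, ((F ω - ∫ η, F η ∂μ : ℝ) : ℂ) * Complex.exp ((l * F ω : ℝ) * Complex.I) ∂μ) -
      l * Complex.I * ((variance F μ : ℝ) * ∫ ω, Complex.exp ((l * F ω : ℝ) * Complex.I) ∂μ)‖ ≤
    l ^ 2 * ∑ i ∈ s, ((2 * ∫ ω, |Y i ω - ∫ η, Y i η ∂μ| * (F ω - F₁ i ω) ^ 2 ∂μ) +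
      ∑ j ∈ s, ((∫ ω, |(Y i ω - ∫ η, Y i η ∂μ) * h i j ω| * |F ω - F₂ i j ω| ∂μ) +
        (∫ ω, |(Y i ω - ∫ η, Y i η ∂μ) * h i j ω| ∂μ) * ∫ ω, |F ω - F₂ i j ω| ∂μ)) := by
  set X : ι → Ω → ℝ := fun i ω => Y i ω - ∫ η, Y i η ∂μ with hX
  have hX0 : ∀ i, ∫ ω, X i ω ∂μ = 0 := fun i => by
    simp [hX, integral_sub (.of_finite : Integrable (Y i) μ) .of_finite]
  have hFX : ∀ ω, F ω - ∫ η, F η ∂μ = ∑ i ∈ s, X i ω := fun ω => by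
    simp only [hX, hF, Finset.sum_sub_distrib]
    rw [integral_finsetSum _ fun _ _ => .of_finite]
  have hXF₁ : ∀ i ∈ s, IndepFun (X i) (F₁ i) μ := fun i hi =>
    (hind₁ i hi).comp (φ := fun x => x - ∫ η, Y i η ∂μ) (ψ := id) (by fun_prop) measurable_id
  have hvar : variance F μ = ∑ i ∈ s, ∑ j ∈ s, ∫ ω, X i ω * h i j ω ∂μ := by
    have h1 : ∀ i ∈ s, ∑ j ∈ s, ∫ ω, X i ω * h i j ω ∂μ = ∫ ω, X i ω * F ω ∂μ := by
      intro i hi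
      rw [← integral_finsetSum _ fun _ _ => .of_finite]
      have h2 : ∫ ω, X i ω * F₁ i ω ∂μ = 0 := by
        rw [(hXF₁ i hi).integral_fun_mul_eq_mul_integral
          Measurable.of_discrete.aestronglyMeasurable Measurable.of_discrete.aestronglyMeasurable,
          hX0, zero_mul]
      rw [← sub_zero (∫ ω, X i ω * F ω ∂μ), ← h2, ← integral_sub .of_finite .of_finite]
      simp only [← Finset.mul_sum, ← hF₁ i hi, mul_sub]
    rw [Finset.sum_congr rfl h1, ← integral_finsetSum _ fun _ _ => .of_finite,
      variance_eq_integral Measurable.of_discrete.aemeasurable]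
    simp only [← Finset.sum_mul, ← hFX]
    have h3 : ∫ ω, (F ω - ∫ η, F η ∂μ) * (∫ η, F η ∂μ) ∂μ = 0 := by
      rw [integral_mul_const, integral_sub .of_finite .of_finite]
      simp
    rw [← sub_zero (∫ ω, (F ω - ∫ η, F η ∂μ) * F ω ∂μ), ← h3,
      ← integral_sub .of_finite .of_finite]
    simp only [← mul_sub, pow_two]
  set E : ℂ := ∫ ω, Complex.exp ((l * F ω : ℝ) * Complex.I) ∂μ with hE
  have heq : (∫ ω, ((F ω - ∫ η, F η ∂μ : ℝ) : ℂ) * Complex.exp ((l * F ω : ℝ) * Complex.I) ∂μ) -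
      l * Complex.I * ((variance F μ : ℝ) * E) =
      ∑ i ∈ s, (((∫ ω, (X i ω : ℂ) * Complex.exp ((l * F ω : ℝ) * Complex.I) ∂μ) -
        l * Complex.I * ∫ ω, ((X i ω * (F ω - F₁ i ω) : ℝ) : ℂ) *
          Complex.exp ((l * F ω : ℝ) * Complex.I) ∂μ) +
        ∑ j ∈ s, l * Complex.I * ((∫ ω, ((X i ω * h i j ω : ℝ) : ℂ) *
          Complex.exp ((l * F ω : ℝ) * Complex.I) ∂μ) -
            ((∫ ω, X i ω * h i j ω ∂μ : ℝ) : ℂ) * E)) := by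
    have h1 : ∫ ω, ((F ω - ∫ η, F η ∂μ : ℝ) : ℂ) * Complex.exp ((l * F ω : ℝ) * Complex.I) ∂μ =
        ∑ i ∈ s, ∫ ω, (X i ω : ℂ) * Complex.exp ((l * F ω : ℝ) * Complex.I) ∂μ := by
      rw [← integral_finsetSum _ fun _ _ => .of_finite]
      simp only [hFX, Complex.ofReal_sum, Finset.sum_mul]
    have h2 : ∀ i ∈ s, ∫ ω, ((X i ω * (F ω - F₁ i ω) : ℝ) : ℂ) *
          Complex.exp ((l * F ω : ℝ) * Complex.I) ∂μ =
        ∑ j ∈ s, ∫ ω, ((X i ω * h i j ω : ℝ) : ℂ) *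
          Complex.exp ((l * F ω : ℝ) * Complex.I) ∂μ := by
      intro i hi
      rw [← integral_finsetSum _ fun _ _ => .of_finite]
      simp only [hF₁ i hi, Finset.mul_sum, Complex.ofReal_sum, Finset.sum_mul]
    rw [h1, hvar, Finset.sum_add_distrib, Finset.sum_sub_distrib, ← Finset.mul_sum,
      Finset.sum_congr rfl h2]
    simp only [← Finset.mul_sum, Finset.sum_sub_distrib, ← Finset.sum_mul, Complex.ofReal_sum]
    ring
  rw [heq, Finset.mul_sum]
  refine norm_sum_le_of_le _ fun i hi => (norm_add_le _ _).trans ?_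
  rw [mul_add, Finset.mul_sum]
  refine add_le_add (norm_integral_centred_mul_cexp_sub_le (hXF₁ i hi) (hX0 i) l)
    (norm_sum_le_of_le _ fun j hj => ?_)
  rw [norm_mul, norm_mul, Complex.norm_real, Complex.norm_I, mul_one, Real.norm_eq_abs,
    ← sq_abs, pow_two, mul_assoc]
  exact mul_le_mul_of_nonneg_left (norm_integral_mul_cexp_sub_le (hind₂ i hi j hj) l) (abs_nonneg _)

/-- If `F` satisfies Stein's identity up to `l ^ 2 M`, then the characteristic function of its
standardization is within `M |s| ^ 3 / σ ^ 3` of that of the standard Gaussian. -/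
theorem norm_charFun_standardized_sub_le {F : Ω → ℝ} {M : ℝ}
    (hM : ∀ l : ℝ,
      ‖(∫ ω, ((F ω - ∫ η, F η ∂μ : ℝ) : ℂ) * Complex.exp ((l * F ω : ℝ) * Complex.I) ∂μ) -
      l * Complex.I * ((variance F μ : ℝ) *
        ∫ ω, Complex.exp ((l * F ω : ℝ) * Complex.I) ∂μ)‖ ≤ l ^ 2 * M)
    (hσ : 0 < √(variance F μ)) (s : ℝ) :
    ‖charFun (μ.map fun ω => (F ω - ∫ η, F η ∂μ) / √(variance F μ)) s -
      Complex.exp (-(s ^ 2 / 2 : ℝ))‖ ≤ M / √(variance F μ) ^ 3 * |s| ^ 3 := by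
  refine norm_charFun_sub_le (fun s => ?_) s
  set σ := √(variance F μ) with hσdef
  set m := ∫ η, F η ∂μ with hm
  have hvar : variance F μ = σ ^ 2 := (Real.sq_sqrt (variance_nonneg _ _)).symm
  have hexp : ∀ ω, Complex.exp ((s * ((F ω - m) / σ) : ℝ) * Complex.I) =
      Complex.exp ((-(s / σ * m) : ℝ) * Complex.I) *
        Complex.exp ((s / σ * F ω : ℝ) * Complex.I) := by
    intro ω
    rw [← Complex.exp_add, ← add_mul, ← Complex.ofReal_add]
    congr 3
    ring
  have hσ' : (σ : ℂ) ≠ 0 := by exact_mod_cast hσ.ne'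
  have h1 : ∫ ω, (((F ω - m) / σ : ℝ) : ℂ) *
      Complex.exp ((s * ((F ω - m) / σ) : ℝ) * Complex.I) ∂μ =
      Complex.exp ((-(s / σ * m) : ℝ) * Complex.I) / σ *
        ∫ ω, ((F ω - m : ℝ) : ℂ) * Complex.exp ((s / σ * F ω : ℝ) * Complex.I) ∂μ := by
    rw [← integral_const_mul]
    congr 1
    ext ω
    rw [hexp, Complex.ofReal_div]
    ring
  have h2 : ∫ ω, Complex.exp ((s * ((F ω - m) / σ) : ℝ) * Complex.I) ∂μ =
      Complex.exp ((-(s / σ * m) : ℝ) * Complex.I) *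
        ∫ ω, Complex.exp ((s / σ * F ω : ℝ) * Complex.I) ∂μ := by
    rw [← integral_const_mul]
    simp only [hexp]
  have heq : (∫ ω, (((F ω - m) / σ : ℝ) : ℂ) *
      Complex.exp ((s * ((F ω - m) / σ) : ℝ) * Complex.I) ∂μ) -
      s * Complex.I * ∫ ω, Complex.exp ((s * ((F ω - m) / σ) : ℝ) * Complex.I) ∂μ =
      Complex.exp ((-(s / σ * m) : ℝ) * Complex.I) / σ *
      ((∫ ω, ((F ω - m : ℝ) : ℂ) * Complex.exp ((s / σ * F ω : ℝ) * Complex.I) ∂μ) -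
      (s / σ : ℝ) * Complex.I * ((variance F μ : ℝ) *
        ∫ ω, Complex.exp ((s / σ * F ω : ℝ) * Complex.I) ∂μ)) := by
    rw [h1, h2, hvar]
    push_cast
    field_simp
  rw [heq, norm_mul, norm_div, Complex.norm_exp_ofReal_mul_I, Complex.norm_real, Real.norm_eq_abs,
    abs_of_pos hσ]
  calc _ ≤ 1 / σ * ((s / σ) ^ 2 * M) := by
        gcongr
        exact hM (s / σ)
    _ = M / σ ^ 3 * s ^ 2 := by
        field_simp

end

/-! ### Sums of semi-induced variables -/

section

variable {V : Type*}

theorem DependsOnEdges.comp_deleteEdges {β : Type*} {A D : Set (Sym2 V)} {f : SimpleGraph V → β}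
    (hf : DependsOnEdges A f) : DependsOnEdges (A \ D) (fun G => f (G.deleteEdges D)) := by
  intro G₁ G₂ h
  apply hf
  ext e
  have := Set.ext_iff.1 h e
  simp only [SimpleGraph.edgeSet_deleteEdges, Set.mem_inter_iff, Set.mem_sdiff] at this ⊢
  tauto

theorem edgesMeeting_mono {A B : Finset V} (h : A ⊆ B) : edgesMeeting A ⊆ edgesMeeting B :=
  fun _ ⟨h₁, x, hx, hxe⟩ => ⟨h₁, x, h hx, hxe⟩

theorem edgesInside_mono {A B : Finset V} (h : A ⊆ B) : edgesInside A ⊆ edgesInside B :=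
  fun _ he x hx => h (he x hx)

variable [DecidableEq V]

theorem connIndicator_deleteEdges_le {K : ℝ} (hK : 0 ≤ K) (S : Finset V) (G : SimpleGraph V)
    (D : Set (Sym2 V)) : connIndicator K S (G.deleteEdges D) ≤ connIndicator K S G := by
  unfold connIndicator
  by_cases h : ((G.deleteEdges D).induce (S : Set V)).Connected
  · have h' : (G.induce (S : Set V)).Connected :=
      h.mono fun x y hxy => G.deleteEdges_le D hxy
    rw [if_pos h, if_pos h']
  · rw [if_neg h]
    split_ifs <;> simp [hK]

variable {𝒰 : Finset (Finset V)} {Y : Finset V → SimpleGraph V → ℝ} {K : ℝ}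

/-- Deleting the edges which meet `A` changes `Y S` only if `S` is connected and touches `A`. -/
theorem abs_sub_deleteEdges_le (hK : 0 ≤ K) {S : Finset V} (hsemi : SemiInduced S (Y S))
    (hY : S.Nonempty → ∀ G, 0 ≤ Y S G ∧ Y S G ≤ connIndicator K S G) (A : Finset V)
    (G : SimpleGraph V) :
    |Y S G - Y S (G.deleteEdges (edgesMeeting A))| ≤ K * exploredIndicator A S G := by
  have hr := mul_nonneg hK (exploredIndicator_nonneg A S G)
  by_cases hlink : ∃ x ∈ A, ∃ y ∈ S, x = y ∨ G.Adj x y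
  · obtain ⟨x, hx, y, hy, hxy⟩ := hlink
    obtain ⟨h₁, h₂⟩ := hY ⟨y, hy⟩ G
    obtain ⟨h₃, h₄⟩ := hY ⟨y, hy⟩ (G.deleteEdges (edgesMeeting A))
    have h₅ := connIndicator_deleteEdges_le hK S G (edgesMeeting A)
    have h₆ : connIndicator K S G ≤ K * exploredIndicator A S G := by
      by_cases hc : (G.induce (S : Set V)).Connected
      · rw [(exploredFrom_of_connected hc ⟨x, hx, y, hy, hxy⟩).indicator_eq, mul_one]
        unfold connIndicator
        rw [if_pos hc]
      · unfold connIndicator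
        rwa [if_neg hc]
    rw [abs_le]
    constructor <;> linarith
  · have : Y S G = Y S (G.deleteEdges (edgesMeeting A)) := by
      apply hsemi
      ext e
      simp only [SimpleGraph.edgeSet_deleteEdges, Set.mem_inter_iff, Set.mem_sdiff]
      refine ⟨fun ⟨he, heS⟩ => ⟨⟨he, fun ⟨_, x, hx, hxe⟩ => ?_⟩, heS⟩,
        fun ⟨⟨he, _⟩, heS⟩ => ⟨he, heS⟩⟩
      obtain ⟨_, y, hy, hye⟩ := heS
      rcases eq_or_ne x y with hxy | hxy
      · exact hlink ⟨x, hx, y, hy, .inl hxy⟩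
      · obtain rfl := (Sym2.mem_and_mem_iff hxy).1 ⟨hxe, hye⟩
        exact hlink ⟨x, hx, y, hy, .inr he⟩
    rw [this, sub_self, abs_zero]
    exact hr

theorem dependsOnEdges_sum_exploredIndicator (𝒰 : Finset (Finset V)) (A : Finset V) :
    DependsOnEdges (edgesInside A)ᶜ (fun G => ∑ S ∈ 𝒰, exploredIndicator A S G) :=
  DependsOnEdges.sum fun S _ => (dependsOnEdges_exploredIndicator A S).mono fun _ h => h.2

variable [Fintype V] {p : unitInterval} {C : ℝ} {t : ℕ}

theorem sum_integral_exploredIndicator_family_le (hC : Fintype.card V * (p : ℝ) ≤ C)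
    (hcard : ∀ U ∈ 𝒰, U.card ≤ t) {a : ℕ} {A : Finset V} (hA : A.card ≤ a) :
    ∑ S ∈ 𝒰, ∫ G, exploredIndicator A S G ∂(SimpleGraph.binomialRandom V p) ≤
      explorationBound C t a := by
  refine le_trans (Finset.sum_le_sum_of_subset_of_nonneg (fun S hS => ?_)
    fun S _ _ => integral_nonneg fun G => exploredIndicator_nonneg A S G)
    (sum_integral_exploredIndicator_le hC t a A hA)
  simpa using (Finset.card_le_card Finset.sdiff_subset).trans (hcard S hS)

theorem abs_sub_integral_le (hK : 0 ≤ K) {U : Finset V} (hsemi : SemiInduced U (Y U))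
    (hY : U.Nonempty → ∀ G, 0 ≤ Y U G ∧ Y U G ≤ connIndicator K U G) (G : SimpleGraph V) :
    |Y U G - ∫ H, Y U H ∂(SimpleGraph.binomialRandom V p)| ≤
      K * (connIndicator 1 U G + ∫ H, connIndicator 1 U H ∂(SimpleGraph.binomialRandom V p)) := by
  have hE : 0 ≤ ∫ H, connIndicator 1 U H ∂(SimpleGraph.binomialRandom V p) :=
    integral_nonneg fun H => connIndicator_nonneg zero_le_one U H
  have hG := connIndicator_nonneg zero_le_one U G
  rcases U.eq_empty_or_nonempty with rfl | hU
  · have hconst : ∀ H, Y ∅ H = Y ∅ G := fun H => hsemi H G (by simp [edgesMeeting])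
    simp only [hconst, integral_const, probReal_univ, one_smul, sub_self, abs_zero]
    positivity
  · have h1 : ∫ H, Y U H ∂(SimpleGraph.binomialRandom V p) ≤
        K * ∫ H, connIndicator 1 U H ∂(SimpleGraph.binomialRandom V p) := by
      rw [← integral_const_mul]
      refine integral_mono .of_finite .of_finite fun H => ?_
      simp only [← connIndicator_eq_mul]
      exact (hY hU H).2
    have h2 : 0 ≤ ∫ H, Y U H ∂(SimpleGraph.binomialRandom V p) :=
      integral_nonneg fun H => (hY hU H).1
    have h3 := (hY hU G).1
    have h4 := (hY hU G).2
    rw [connIndicator_eq_mul] at h4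
    have h5 := mul_nonneg hK hE
    have h6 := mul_nonneg hK hG
    rw [abs_le]
    constructor <;> linarith

/-- The three explorations of `U`, of `S` from `U`, and of further sets from `U ∪ S` use disjoint
sets of edges, so they are independent. -/
theorem integral_exploration_chain (𝒰 : Finset (Finset V)) (U S : Finset V)
    {q : SimpleGraph V → ℝ} (hq : DependsOnEdges (edgesInside U) q) :
    ∫ G, q G * (exploredIndicator U S G * ∑ T ∈ 𝒰, exploredIndicator (U ∪ S) T G)
      ∂(SimpleGraph.binomialRandom V p) =
    (∫ G, q G ∂(SimpleGraph.binomialRandom V p)) *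
      ((∫ G, exploredIndicator U S G ∂(SimpleGraph.binomialRandom V p)) *
        ∫ G, ∑ T ∈ 𝒰, exploredIndicator (U ∪ S) T G ∂(SimpleGraph.binomialRandom V p)) := by
  have h1 := dependsOnEdges_exploredIndicator U S
  have h2 := dependsOnEdges_sum_exploredIndicator 𝒰 (U ∪ S)
  rw [hq.integral_mul (B := (edgesInside U)ᶜ) p ?_ disjoint_compl_right, h1.integral_mul p h2]
  · exact Set.disjoint_compl_right_iff_subset.2 Set.sdiff_subset
  · exact (h1.mono fun _ h => h.2).map₂
      (h2.mono (Set.compl_subset_compl.2 (edgesInside_mono Finset.subset_union_left))) (· * ·)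

/-- Stein's identity for the sum of a family of semi-induced variables, with an error which is
linear in the number of vertices. -/
theorem norm_integral_semiInduced_sub_le (hK : 0 ≤ K) (hC : Fintype.card V * (p : ℝ) ≤ C)
    (hcard : ∀ U ∈ 𝒰, U.card ≤ t) (hsemi : ∀ U ∈ 𝒰, SemiInduced U (Y U))
    (hY : ∀ U ∈ 𝒰, U.Nonempty → ∀ G, 0 ≤ Y U G ∧ Y U G ≤ connIndicator K U G) (l : ℝ) :
    ‖(∫ G, ((∑ U ∈ 𝒰, Y U G - ∫ H, ∑ U ∈ 𝒰, Y U H ∂(SimpleGraph.binomialRandom V p) : ℝ) : ℂ) *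
        Complex.exp ((l * ∑ U ∈ 𝒰, Y U G : ℝ) * Complex.I) ∂(SimpleGraph.binomialRandom V p)) -
      l * Complex.I * ((variance (fun G => ∑ U ∈ 𝒰, Y U G) (SimpleGraph.binomialRandom V p) : ℝ) *
        ∫ G, Complex.exp ((l * ∑ U ∈ 𝒰, Y U G : ℝ) * Complex.I)
          ∂(SimpleGraph.binomialRandom V p))‖ ≤
    l ^ 2 * (8 * K ^ 3 * explorationBound C t 1 * explorationBound C t t *
      explorationBound C t (2 * t) * Fintype.card V) := by
  set μ := SimpleGraph.binomialRandom V p with hμ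
  have hC0 : 0 ≤ C := le_trans (mul_nonneg (Nat.cast_nonneg _) p.2.1) hC
  set F : SimpleGraph V → ℝ := fun G => ∑ U ∈ 𝒰, Y U G with hF
  set r : Finset V → Finset V → SimpleGraph V → ℝ := exploredIndicator with hr
  set R : Finset V → SimpleGraph V → ℝ := fun A G => ∑ S ∈ 𝒰, r A S G with hR
  set q : Finset V → SimpleGraph V → ℝ :=
    fun U G => connIndicator 1 U G + ∫ H, connIndicator 1 U H ∂μ with hq
  set h : Finset V → Finset V → SimpleGraph V → ℝ :=
    fun U S G => Y S G - Y S (G.deleteEdges (edgesMeeting U)) with hh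
  have hr0 : ∀ A S G, 0 ≤ r A S G := exploredIndicator_nonneg
  have hq0 : ∀ U G, 0 ≤ q U G := fun U G => add_nonneg (connIndicator_nonneg zero_le_one U G)
    (integral_nonneg fun H => connIndicator_nonneg zero_le_one U H)
  have hhr : ∀ U, ∀ S ∈ 𝒰, ∀ G, |h U S G| ≤ K * r U S G := fun U S hS G =>
    abs_sub_deleteEdges_le hK (hsemi S hS) (hY S hS) U G
  have hFsub : ∀ A G, F G - F (G.deleteEdges (edgesMeeting A)) = ∑ S ∈ 𝒰, h A S G := fun A G => by
    simp only [hF, hh, Finset.sum_sub_distrib]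
  have hFR : ∀ A G, |F G - F (G.deleteEdges (edgesMeeting A))| ≤ K * R A G := fun A G => by
    rw [hFsub, hR, Finset.mul_sum]
    exact (Finset.abs_sum_le_sum_abs _ _).trans (Finset.sum_le_sum fun S hS => hhr A S hS G)
  have hXq : ∀ U ∈ 𝒰, ∀ G, |Y U G - ∫ H, Y U H ∂μ| ≤ K * q U G := fun U hU G =>
    abs_sub_integral_le hK (hsemi U hU) (hY U hU) G
  have hqdep : ∀ U, DependsOnEdges (edgesInside U) (q U) := fun U =>
    (dependsOnEdges_connIndicator 1 U).comp (· + ∫ H, connIndicator 1 U H ∂μ)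
  have hsemi' : ∀ S ∈ 𝒰, ∀ A, DependsOnEdges (edgesMeeting A)ᶜ
      (fun G => Y S (G.deleteEdges (edgesMeeting A))) := fun S hS A =>
    (DependsOnEdges.comp_deleteEdges (D := edgesMeeting A) (hsemi S hS)).mono fun _ he => he.2
  have hF' : ∀ A, DependsOnEdges (edgesMeeting A)ᶜ
      (fun G => F (G.deleteEdges (edgesMeeting A))) := fun A =>
    DependsOnEdges.sum fun S hS => hsemi' S hS A
  have hind₁ : ∀ U ∈ 𝒰, IndepFun (Y U) (fun G => F (G.deleteEdges (edgesMeeting U))) μ :=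
    fun U hU => DependsOnEdges.indepFun p (hsemi U hU) (hF' U) disjoint_compl_right
  have hind₂ : ∀ U ∈ 𝒰, ∀ S ∈ 𝒰, IndepFun (fun G => (Y U G - ∫ H, Y U H ∂μ) * h U S G)
      (fun G => F (G.deleteEdges (edgesMeeting (U ∪ S)))) μ := by
    intro U hU S hS
    refine DependsOnEdges.indepFun p ?_ (hF' (U ∪ S)) disjoint_compl_right
    have hU' : DependsOnEdges (edgesMeeting U) (Y U) := hsemi U hU
    have hS' : DependsOnEdges (edgesMeeting S) (Y S) := hsemi S hS
    have hSm := edgesMeeting_mono (Finset.subset_union_right : S ⊆ U ∪ S)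
    refine DependsOnEdges.map₂ (DependsOnEdges.comp
      (hU'.mono (edgesMeeting_mono Finset.subset_union_left)) (· - ∫ H, Y U H ∂μ)) ?_ (· * ·)
    exact (hS'.mono hSm).map₂ (hS'.comp_deleteEdges.mono (Set.sdiff_subset.trans hSm)) (· - ·)
  refine (norm_integral_decomposable_sub_le (s := 𝒰) (h := h) (fun _ => rfl)
    (fun U _ G => hFsub U G) hind₁ hind₂ l).trans (mul_le_mul_of_nonneg_left ?_ (sq_nonneg l))
  -- each of the error terms is a sum over chains of explorations
  set c : Finset V → ℝ := fun U => ∫ G, connIndicator 1 U G ∂μ with hc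
  have hc0 : ∀ U, 0 ≤ c U := fun U =>
    integral_nonneg fun H => connIndicator_nonneg zero_le_one U H
  have hqc : ∀ U, ∫ G, q U G ∂μ = 2 * c U := fun U => by
    rw [integral_add .of_finite .of_finite, integral_const]
    simp [hc]
    ring
  have hchain : ∀ U S, ∫ G, q U G * (r U S G * R (U ∪ S) G) ∂μ =
      2 * c U * ((∫ G, r U S G ∂μ) * ∫ G, R (U ∪ S) G ∂μ) := fun U S => by
    rw [← hqc]
    exact integral_exploration_chain 𝒰 U S (hqdep U)
  have hlink : ∀ U S, ∫ G, q U G * r U S G ∂μ = 2 * c U * ∫ G, r U S G ∂μ := fun U S => by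
    rw [← hqc]
    exact (hqdep U).integral_mul p (dependsOnEdges_exploredIndicator U S) Set.disjoint_sdiff_right
  have hmoment : ∀ U ∈ 𝒰, ∀ S ∈ 𝒰, ∀ G,
      |(Y U G - ∫ H, Y U H ∂μ) * h U S G| ≤ K ^ 2 * (q U G * r U S G) := fun U hU S hS G => by
    rw [abs_mul]
    calc _ ≤ (K * q U G) * (K * r U S G) :=
          mul_le_mul (hXq U hU G) (hhr U S hS G) (abs_nonneg _) (mul_nonneg hK (hq0 U G))
      _ = _ := by ring
  have hterm : ∀ U ∈ 𝒰,
      (2 * ∫ G, |Y U G - ∫ H, Y U H ∂μ| * (F G - F (G.deleteEdges (edgesMeeting U))) ^ 2 ∂μ) +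
      ∑ S ∈ 𝒰, ((∫ G, |(Y U G - ∫ H, Y U H ∂μ) * h U S G| *
          |F G - F (G.deleteEdges (edgesMeeting (U ∪ S)))| ∂μ) +
        (∫ G, |(Y U G - ∫ H, Y U H ∂μ) * h U S G| ∂μ) *
          ∫ G, |F G - F (G.deleteEdges (edgesMeeting (U ∪ S)))| ∂μ) ≤
      ∑ S ∈ 𝒰, 8 * K ^ 3 * c U * ((∫ G, r U S G ∂μ) * ∫ G, R (U ∪ S) G ∂μ) := by
    intro U hU
    have h1 : ∫ G, |Y U G - ∫ H, Y U H ∂μ| * (F G - F (G.deleteEdges (edgesMeeting U))) ^ 2 ∂μ ≤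
        ∑ S ∈ 𝒰, K ^ 3 * (2 * c U * ((∫ G, r U S G ∂μ) * ∫ G, R (U ∪ S) G ∂μ)) := by
      rw [Finset.sum_congr rfl fun S _ => by rw [← hchain, ← integral_const_mul],
        ← integral_finsetSum _ fun _ _ => .of_finite]
      refine integral_mono .of_finite .of_finite fun G => ?_
      have hsq : (F G - F (G.deleteEdges (edgesMeeting U))) ^ 2 ≤ (K * R U G) ^ 2 := by
        rw [← sq_abs]
        gcongr
        exact hFR U G
      calc _ ≤ (K * q U G) * (K * R U G) ^ 2 :=
            mul_le_mul (hXq U hU G) hsq (sq_nonneg _) (mul_nonneg hK (hq0 U G))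
        _ = K ^ 3 * (q U G * ∑ S ∈ 𝒰, r U S G * R U G) := by
            rw [← Finset.sum_mul]
            ring
        _ ≤ K ^ 3 * (q U G * ∑ S ∈ 𝒰, r U S G * R (U ∪ S) G) := by
            have := hq0 U G
            gcongr with S hS
            · exact hr0 U S G
            · exact Finset.sum_le_sum fun T _ =>
                exploredIndicator_mono_left Finset.subset_union_left T G
        _ = _ := by
            simp only [Finset.mul_sum]
    have h2 : ∀ S ∈ 𝒰, (∫ G, |(Y U G - ∫ H, Y U H ∂μ) * h U S G| *
          |F G - F (G.deleteEdges (edgesMeeting (U ∪ S)))| ∂μ) ≤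
        K ^ 3 * (2 * c U * ((∫ G, r U S G ∂μ) * ∫ G, R (U ∪ S) G ∂μ)) := by
      intro S hS
      rw [← hchain, ← integral_const_mul]
      refine integral_mono .of_finite .of_finite fun G => ?_
      calc _ ≤ (K ^ 2 * (q U G * r U S G)) * (K * R (U ∪ S) G) :=
            mul_le_mul (hmoment U hU S hS G) (hFR _ G) (abs_nonneg _)
              (mul_nonneg (sq_nonneg K) (mul_nonneg (hq0 U G) (hr0 U S G)))
        _ = _ := by ring
    have h3 : ∀ S ∈ 𝒰, (∫ G, |(Y U G - ∫ H, Y U H ∂μ) * h U S G| ∂μ) *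
          ∫ G, |F G - F (G.deleteEdges (edgesMeeting (U ∪ S)))| ∂μ ≤
        K ^ 3 * (2 * c U * ((∫ G, r U S G ∂μ) * ∫ G, R (U ∪ S) G ∂μ)) := by
      intro S hS
      calc _ ≤ (∫ G, K ^ 2 * (q U G * r U S G) ∂μ) * ∫ G, K * R (U ∪ S) G ∂μ := by
            refine mul_le_mul (integral_mono .of_finite .of_finite (hmoment U hU S hS))
              (integral_mono .of_finite .of_finite (hFR _)) (integral_nonneg fun _ => abs_nonneg _)
              (integral_nonneg fun G =>
                mul_nonneg (sq_nonneg K) (mul_nonneg (hq0 U G) (hr0 U S G)))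
        _ = _ := by
            rw [integral_const_mul, integral_const_mul, hlink]
            ring
    refine (add_le_add (mul_le_mul_of_nonneg_left h1 zero_le_two)
      (Finset.sum_le_sum fun S hS => add_le_add (h2 S hS) (h3 S hS))).trans_eq ?_
    rw [Finset.mul_sum, ← Finset.sum_add_distrib]
    refine Finset.sum_congr rfl fun S _ => ?_
    ring
  have hB0 := explorationBound_nonneg hC0 t t
  have hB0' := explorationBound_nonneg hC0 t (2 * t)
  calc _ ≤ ∑ U ∈ 𝒰, ∑ S ∈ 𝒰, 8 * K ^ 3 * c U * ((∫ G, r U S G ∂μ) * ∫ G, R (U ∪ S) G ∂μ) :=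
        Finset.sum_le_sum hterm
    _ ≤ ∑ U ∈ 𝒰, ∑ S ∈ 𝒰, 8 * K ^ 3 * c U *
          ((∫ G, r U S G ∂μ) * explorationBound C t (2 * t)) := by
        refine Finset.sum_le_sum fun U hU => Finset.sum_le_sum fun S hS => ?_
        have := hc0 U
        have := integral_nonneg (μ := μ) (f := r U S) (hr0 U S)
        gcongr
        rw [integral_finsetSum _ fun _ _ => .of_finite]
        refine sum_integral_exploredIndicator_family_le hC hcard ?_
        have := Finset.card_union_le U S
        have := hcard U hU
        have := hcard S hS
        omega
    _ ≤ ∑ U ∈ 𝒰, 8 * K ^ 3 * c U *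
          (explorationBound C t t * explorationBound C t (2 * t)) := by
        refine Finset.sum_le_sum fun U hU => ?_
        rw [← Finset.mul_sum, ← Finset.sum_mul]
        have := hc0 U
        gcongr
        exact sum_integral_exploredIndicator_family_le hC hcard (hcard U hU)
    _ = 8 * K ^ 3 * (explorationBound C t t * explorationBound C t (2 * t)) * ∑ U ∈ 𝒰, c U := by
        rw [Finset.mul_sum]
        refine Finset.sum_congr rfl fun U _ => ?_
        ring
    _ ≤ 8 * K ^ 3 * (explorationBound C t t * explorationBound C t (2 * t)) *
          (Fintype.card V * explorationBound C t 1) := by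
        gcongr
        refine le_trans (Finset.sum_le_sum_of_subset_of_nonneg (fun S hS => ?_)
          fun S _ _ => hc0 S) (sum_integral_connIndicator_le hC t)
        simpa using hcard S hS
    _ = _ := by ring

end

/-- The central limit theorem for a sum of semi-induced variables bounded by the indicators of
connectedness. -/
theorem satisfiesCLT_of_semiInduced {p : ℕ → unitInterval} {K : ℝ} {t : ℕ}
    {𝒰 : (n : ℕ) → Finset (Finset (Fin n))}
    {Y : (n : ℕ) → Finset (Fin n) → SimpleGraph (Fin n) → ℝ}
    (hK : 0 ≤ K) (hcard : ∀ n, ∀ U ∈ 𝒰 n, U.card ≤ t)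
    (hsemi : ∀ n, ∀ U ∈ 𝒰 n, SemiInduced U (Y n U))
    (hY : ∀ᶠ n in atTop, ∀ U ∈ 𝒰 n, U.Nonempty →
      ∀ G, 0 ≤ Y n U G ∧ Y n U G ≤ connIndicator K U G)
    (hp : (fun n : ℕ => (p n : ℝ)) =O[atTop] (fun n : ℕ => 1 / (n : ℝ)))
    (hσ : (fun n : ℕ => (n : ℝ) ^ ((1 : ℝ) / 3)) =o[atTop]
        (fun n : ℕ => √(variance (fun G => ∑ U ∈ 𝒰 n, Y n U G)
          (SimpleGraph.binomialRandom (Fin n) (p n))))) :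
    SatisfiesCLT p (fun n G => ∑ U ∈ 𝒰 n, Y n U G) := by
  refine ⟨fun n => Measurable.of_discrete.aemeasurable, by fun_prop, ?_⟩
  refine ProbabilityMeasure.tendsto_iff_tendsto_charFun.2 fun s => ?_
  simp only [ProbabilityMeasure.coe_mk, Measure.map_id, charFun_gaussianReal]
  obtain ⟨C, hC⟩ := hp.bound
  set σ : ℕ → ℝ := fun n => √(variance (fun G => ∑ U ∈ 𝒰 n, Y n U G)
    (SimpleGraph.binomialRandom (Fin n) (p n))) with hσdef
  set B := 8 * K ^ 3 * explorationBound C t 1 * explorationBound C t t *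
    explorationBound C t (2 * t) with hB
  have hlim : Tendsto (fun n : ℕ => B * ((n : ℝ) / σ n ^ 3) * |s| ^ 3) atTop (𝓝 0) := by
    have h1 := (hσ.pow (n := 3) (by norm_num)).tendsto_div_nhds_zero
    have h2 : ∀ n : ℕ, ((n : ℝ) ^ ((1 : ℝ) / 3)) ^ 3 = n := fun n => by
      rw [← Real.rpow_natCast, ← Real.rpow_mul (Nat.cast_nonneg n)]
      norm_num
    simp only [h2] at h1
    simpa using (h1.const_mul B).mul_const (|s| ^ 3)
  rw [tendsto_iff_norm_sub_tendsto_zero]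
  refine squeeze_zero' (.of_forall fun n => norm_nonneg _) ?_ hlim
  filter_upwards [hC, hY, hσ.bound one_pos, eventually_gt_atTop 0] with n hCn hYn hσn hn
  have hn' : (0 : ℝ) < n := by exact_mod_cast hn
  have hσpos : 0 < σ n := by
    have h1 : 0 < (n : ℝ) ^ ((1 : ℝ) / 3) := Real.rpow_pos_of_pos hn' _
    rw [one_mul, Real.norm_of_nonneg h1.le, Real.norm_of_nonneg (Real.sqrt_nonneg _)] at hσn
    exact h1.trans_le hσn
  have hCn' : Fintype.card (Fin n) * (p n : ℝ) ≤ C := by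
    rw [Real.norm_of_nonneg (p n).2.1, Real.norm_of_nonneg (by positivity)] at hCn
    rw [Fintype.card_fin]
    calc (n : ℝ) * (p n : ℝ) ≤ n * (C * (1 / n)) := by gcongr
      _ = C := by field_simp
  have key := norm_charFun_standardized_sub_le (F := fun G => ∑ U ∈ 𝒰 n, Y n U G)
    (norm_integral_semiInduced_sub_le hK hCn' (hcard n) (hsemi n) hYn) hσpos s
  rw [Fintype.card_fin] at key
  convert! key using 2
  · congr 2
    push_cast
    simp
  · rw [hB, hσdef]
    ring

/-! ### Neighbourhood sums -/

theorem mem_closedNbhd_succ {V : Type*} {G : SimpleGraph V} {v w : V} {k : ℕ} :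
    w ∈ closedNbhd G v (k + 1) ↔
      w ∈ closedNbhd G v k ∨ ∃ u ∈ closedNbhd G v k, G.Adj u w := by
  constructor
  · intro h
    have hreach : G.edist v w ≠ ⊤ := ne_top_of_le_ne_top (ENat.natCast_ne_top _) h
    obtain ⟨p, hp⟩ := SimpleGraph.exists_walk_of_edist_ne_top hreach
    have hlen : p.length ≤ k + 1 := by
      have h' : G.edist v w ≤ ((k + 1 : ℕ) : ℕ∞) := h
      rw [← hp] at h'
      exact_mod_cast h'
    rcases Nat.lt_or_ge p.length (k + 1) with hlt | hge
    · left
      have : G.edist v w ≤ (k : ℕ∞) := by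
        rw [← hp]
        exact_mod_cast Nat.lt_succ_iff.1 hlt
      exact this
    · right
      have hnil : ¬ p.Nil := by
        rw [← SimpleGraph.Walk.length_eq_zero_iff]
        omega
      refine ⟨p.penultimate, ?_, p.adj_penultimate hnil⟩
      have h2 : G.edist v p.penultimate ≤ (p.dropLast.length : ℕ∞) :=
        SimpleGraph.Walk.edist_le _
      refine h2.trans ?_
      have h3 : p.dropLast.length ≤ k := by
        simp
        omega
      exact_mod_cast h3
  · rintro (h | ⟨u, hu, huw⟩)
    · have h' : G.edist v w ≤ (k : ℕ∞) := h
      exact h'.trans (by exact_mod_cast Nat.le_succ k)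
    · have hu' : G.edist v u ≤ (k : ℕ∞) := hu
      have h1 : G.edist v w ≤ G.edist v u + G.edist u w := SimpleGraph.edist_triangle
      rw [SimpleGraph.edist_eq_one_iff_adj.2 huw] at h1
      exact h1.trans (by push_cast; gcongr)

theorem closedNbhd_mono {V : Type*} (G : SimpleGraph V) (v : V) {j k : ℕ} (h : j ≤ k) :
    closedNbhd G v j ⊆ closedNbhd G v k := fun w hw =>
  le_trans (show G.edist v w ≤ (j : ℕ∞) from hw) (by exact_mod_cast h)

/-- The ball around `v` does not change if the graph changes only outside of the ball. -/
theorem closedNbhd_congr {V : Type*} {G₁ G₂ : SimpleGraph V} {v : V} {k : ℕ} {U : Set V}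
    (hU : closedNbhd G₁ v k = U) (h₁₂ : ∀ x ∈ U, ∀ y ∈ U, G₁.Adj x y → G₂.Adj x y)
    (h₂₁ : ∀ x ∈ U, ∀ y, G₂.Adj x y → G₁.Adj x y) : closedNbhd G₂ v k = U := by
  suffices h : ∀ j ≤ k, closedNbhd G₂ v j = closedNbhd G₁ v j by rw [h k le_rfl, hU]
  intro j
  induction j with
  | zero =>
    intro _
    ext w
    simp [closedNbhd]
  | succ j ih =>
    intro hj
    have ih := ih (by omega)
    ext w
    rw [mem_closedNbhd_succ, mem_closedNbhd_succ, ih]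
    have hsub := closedNbhd_mono G₁ v (show j ≤ k by omega)
    refine or_congr_right (exists_congr fun u => and_congr_right fun hu => ?_)
    have huU : u ∈ U := hU ▸ hsub hu
    refine ⟨h₂₁ u huU w, fun huw => h₁₂ u huU w ?_ huw⟩
    rw [← hU]
    exact closedNbhd_mono G₁ v hj (mem_closedNbhd_succ.2 (.inr ⟨u, hu, huw⟩))

theorem cls_rootedNbhd_congr {V : Type} [Finite V] {G₁ G₂ : SimpleGraph V} {v : V} {k : ℕ}
    {U : Set V} (h₁ : closedNbhd G₁ v k = U) (h₂ : closedNbhd G₂ v k = U)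
    (h : ∀ x ∈ U, ∀ y ∈ U, G₁.Adj x y ↔ G₂.Adj x y) :
    (rootedNbhd G₁ v k).cls = (rootedNbhd G₂ v k).cls := by
  refine Quotient.sound ⟨⟨Equiv.setCongr (h₁.trans h₂.symm), ?_⟩, rfl⟩
  rintro ⟨x, hx⟩ ⟨y, hy⟩
  exact (h x (h₁ ▸ hx) y (h₁ ▸ hy)).symm

open Classical in
/-- The contribution of the vertex `v` to `truncatedNbhdSum`. -/
noncomputable def nbhdWeight (c : ℝ) (k : ℕ) (β : RootedGraph.IsoClass → ℝ) {V : Type} [Finite V]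
    (G : SimpleGraph V) (v : V) : ℝ :=
  if (rootedNbhd G v k).cls ∈ RootedGraph.treeClasses c k then β (rootedNbhd G v k).cls else 0

open Classical in
/-- The contribution to `truncatedNbhdSum` of the vertices whose ball of radius `k` is `U`. -/
noncomputable def nbhdSumOn (c : ℝ) (k : ℕ) (β : RootedGraph.IsoClass → ℝ) {V : Type} [Fintype V]
    (U : Finset V) (G : SimpleGraph V) : ℝ :=
  ∑ v, if closedNbhd G v k = (U : Set V) then nbhdWeight c k β G v else 0

section

variable {c : ℝ} {k : ℕ} {β : RootedGraph.IsoClass → ℝ} {V : Type} [Fintype V]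

theorem truncatedNbhdSum_eq_sum_nbhdWeight (G : SimpleGraph V) :
    truncatedNbhdSum c k β G = ∑ v, nbhdWeight c k β G v := by
  classical
  unfold truncatedNbhdSum nbhdSum nbhdWeight
  refine Finset.sum_congr rfl fun v _ => ?_
  rw [finsum_eq_single _ (rootedNbhd G v k).cls fun τ hτ => by simp [Ne.symm hτ]]
  rw [finsum_eq_if]
  simp

theorem mem_treeClasses_rootedNbhd {G : SimpleGraph V} {v : V}
    (h : (rootedNbhd G v k).cls ∈ RootedGraph.treeClasses c k) :
    (G.induce (closedNbhd G v k)).Connected ∧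
      ((closedNbhd G v k).ncard : ℝ) ≤ (10 * c * k) ^ (2 * k) := by
  obtain ⟨H, ⟨-, htree, -, hcard⟩, hH⟩ := h
  obtain ⟨f, -⟩ : RootedGraph.Iso H (rootedNbhd G v k) := Quotient.exact hH
  refine ⟨f.connected_iff.1 htree.connected, ?_⟩
  rw [Nat.card_congr f.toEquiv] at hcard
  exact hcard

theorem treeClasses_subset_radiusClasses :
    RootedGraph.treeClasses c k ⊆ RootedGraph.radiusClasses k :=
  Set.image_mono fun _ h => h.1

theorem nbhdWeight_nonneg (hβ : ∀ τ ∈ RootedGraph.radiusClasses k, 0 ≤ β τ ∧ β τ ≤ 1)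
    (G : SimpleGraph V) (v : V) : 0 ≤ nbhdWeight c k β G v := by
  unfold nbhdWeight
  split_ifs with h
  · exact (hβ _ (treeClasses_subset_radiusClasses h)).1
  · exact le_rfl

theorem nbhdWeight_le_one (hβ : ∀ τ ∈ RootedGraph.radiusClasses k, 0 ≤ β τ ∧ β τ ≤ 1)
    (G : SimpleGraph V) (v : V) : nbhdWeight c k β G v ≤ 1 := by
  unfold nbhdWeight
  split_ifs with h
  · exact (hβ _ (treeClasses_subset_radiusClasses h)).2
  · exact zero_le_one

/-- Every ball which contributes to the truncated sum has at most `(10 c k) ^ (2 k)` vertices. -/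
theorem truncatedNbhdSum_eq_sum_nbhdSumOn {t : ℕ} (ht : t = ⌊(10 * c * k) ^ (2 * k)⌋₊)
    (G : SimpleGraph V) :
    truncatedNbhdSum c k β G = ∑ U : Finset V with U.card ≤ t, nbhdSumOn c k β U G := by
  classical
  unfold nbhdSumOn
  rw [truncatedNbhdSum_eq_sum_nbhdWeight, Finset.sum_comm]
  refine Finset.sum_congr rfl fun v _ => ?_
  by_cases h : (rootedNbhd G v k).cls ∈ RootedGraph.treeClasses c k
  · have hcard := (mem_treeClasses_rootedNbhd h).2
    have hU : ((closedNbhd G v k).toFinset : Set V) = closedNbhd G v k := by simp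
    rw [Finset.sum_eq_single (closedNbhd G v k).toFinset, if_pos hU.symm]
    · intro U _ hne
      refine if_neg fun heq => hne ?_
      rw [← Finset.coe_inj, hU, heq]
    · intro hnot
      refine absurd ?_ hnot
      simp only [Finset.mem_filter, Finset.mem_univ, true_and, ht]
      rw [← Set.ncard_eq_toFinset_card']
      exact Nat.le_floor hcard
  · have h0 : nbhdWeight c k β G v = 0 := if_neg h
    simp [h0]

/-- If `G₂` agrees with `G₁` inside `U` and has no further edges meeting `U`, then the balls equal
to `U` in `G₁` are unchanged in `G₂`. -/
theorem nbhdSumOn_le_of_adj (hβ : ∀ τ ∈ RootedGraph.radiusClasses k, 0 ≤ β τ ∧ β τ ≤ 1)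
    {U : Finset V} {G₁ G₂ : SimpleGraph V}
    (h₁₂ : ∀ x ∈ U, ∀ y ∈ U, G₁.Adj x y → G₂.Adj x y)
    (h₂₁ : ∀ x ∈ U, ∀ y, G₂.Adj x y → G₁.Adj x y) :
    nbhdSumOn c k β U G₁ ≤ nbhdSumOn c k β U G₂ := by
  classical
  unfold nbhdSumOn
  refine Finset.sum_le_sum fun v _ => ?_
  by_cases hv : closedNbhd G₁ v k = (U : Set V)
  · have hv₂ := closedNbhd_congr hv h₁₂ h₂₁
    rw [if_pos hv, if_pos hv₂]
    unfold nbhdWeight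
    rw [cls_rootedNbhd_congr hv hv₂ fun x hx y hy => ⟨h₁₂ x hx y hy, h₂₁ x hx y⟩]
  · rw [if_neg hv]
    split_ifs
    · exact nbhdWeight_nonneg hβ _ _
    · exact le_rfl

theorem semiInduced_nbhdSumOn (hβ : ∀ τ ∈ RootedGraph.radiusClasses k, 0 ≤ β τ ∧ β τ ≤ 1)
    (U : Finset V) : SemiInduced U (nbhdSumOn c k β U) := by
  intro G₁ G₂ h
  have hadj : ∀ x ∈ U, ∀ y, G₁.Adj x y ↔ G₂.Adj x y := by
    intro x hx y
    rcases eq_or_ne x y with rfl | hxy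
    · simp
    have := Set.ext_iff.1 h s(x, y)
    have hm : s(x, y) ∈ edgesMeeting U := ⟨by simpa using hxy, x, hx, by simp⟩
    simpa [hm] using this
  exact le_antisymm
    (nbhdSumOn_le_of_adj hβ (fun x hx y _ => (hadj x hx y).1) fun x hx y => (hadj x hx y).2)
    (nbhdSumOn_le_of_adj hβ (fun x hx y _ => (hadj x hx y).2) fun x hx y => (hadj x hx y).1)

theorem nbhdSumOn_nonneg (hβ : ∀ τ ∈ RootedGraph.radiusClasses k, 0 ≤ β τ ∧ β τ ≤ 1)
    (U : Finset V) (G : SimpleGraph V) : 0 ≤ nbhdSumOn c k β U G :=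
  Finset.sum_nonneg fun v _ => by
    split_ifs
    · exact nbhdWeight_nonneg hβ _ _
    · exact le_rfl

theorem nbhdSumOn_le_connIndicator
    (hβ : ∀ τ ∈ RootedGraph.radiusClasses k, 0 ≤ β τ ∧ β τ ≤ 1) {K : ℝ} {U : Finset V}
    (hU : (U.card : ℝ) ≤ K) (G : SimpleGraph V) :
    nbhdSumOn c k β U G ≤ connIndicator K U G := by
  classical
  unfold connIndicator
  split_ifs with hc
  · refine le_trans ?_ hU
    calc nbhdSumOn c k β U G ≤ ∑ v : V, if v ∈ U then (1 : ℝ) else 0 := by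
          refine Finset.sum_le_sum fun v _ => ?_
          by_cases hv : closedNbhd G v k = (U : Set V)
          · have hvU : v ∈ U := by
              have : v ∈ closedNbhd G v k := by simp [closedNbhd]
              rwa [hv] at this
            rw [if_pos hv, if_pos hvU]
            exact nbhdWeight_le_one hβ G v
          · rw [if_neg hv]
            split_ifs <;> simp
      _ = U.card := by simp
  · refine Finset.sum_nonpos fun v _ => ?_
    split_ifs with hv
    · unfold nbhdWeight
      refine (if_neg fun h => hc ?_).le
      have := (mem_treeClasses_rootedNbhd h).1
      rwa [hv] at this
    · exact le_rfl

end

/-- The central limit theorem for a sum of semi-induced variables which are monotone under the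
deletion of boundary edges. The hypothesis at any boundary pair of `U` gives the bound
`0 ≤ Y U ≤ K 𝟙{G[U] is connected}`; such a pair exists unless `U` is empty or the whole set. -/
theorem satisfiesCLT_of_semiInduced_of_deleteEdges {p : ℕ → unitInterval} {K t : ℝ}
    {𝒰 : (n : ℕ) → Finset (Finset (Fin n))}
    {Y : (n : ℕ) → Finset (Fin n) → SimpleGraph (Fin n) → ℝ}
    (hK : 0 < K) (hcard : ∀ n, ∀ U ∈ 𝒰 n, (U.card : ℝ) ≤ t)
    (hsemi : ∀ n, ∀ U ∈ 𝒰 n, SemiInduced U (Y n U))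
    (hY : ∀ n, ∀ U ∈ 𝒰 n, ∀ (G : SimpleGraph (Fin n)) (e : Sym2 (Fin n)),
        ¬ e.IsDiag → (U.filter (fun x => x ∈ e)).card = 1 →
          0 ≤ Y n U G ∧ Y n U G ≤ Y n U (G.deleteEdges {e}) ∧
            Y n U (G.deleteEdges {e}) ≤ connIndicator K U G)
    (hp : (fun n : ℕ => (p n : ℝ)) =O[atTop] (fun n : ℕ => 1 / (n : ℝ)))
    (hσ : (fun n : ℕ => (n : ℝ) ^ ((1 : ℝ) / 3)) =o[atTop]
        (fun n : ℕ => √(variance (fun G => ∑ U ∈ 𝒰 n, Y n U G)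
          (SimpleGraph.binomialRandom (Fin n) (p n))))) :
    SatisfiesCLT p (fun n G => ∑ U ∈ 𝒰 n, Y n U G) := by
  have hcard' : ∀ n, ∀ U ∈ 𝒰 n, U.card ≤ ⌊t⌋₊ := fun n U hU => Nat.le_floor (hcard n U hU)
  refine satisfiesCLT_of_semiInduced hK.le hcard' hsemi ?_ hp hσ
  filter_upwards [eventually_gt_atTop ⌊t⌋₊] with n hn U hU hne G
  -- as `n > t`, the set `U` is not the whole vertex set
  obtain ⟨x, hx⟩ := hne
  obtain ⟨y, hy⟩ : ∃ y, y ∉ U := by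
    by_contra! hall
    have h1 := hcard' n U hU
    rw [Finset.eq_univ_iff_forall.2 hall, Finset.card_univ, Fintype.card_fin] at h1
    omega
  have hxy : x ≠ y := fun h => hy (h ▸ hx)
  have hfil : (U.filter (fun z => z ∈ s(x, y))) = {x} := by
    ext z
    simp only [Finset.mem_filter, Sym2.mem_iff, Finset.mem_singleton]
    constructor
    · rintro ⟨hz, rfl | rfl⟩
      · rfl
      · exact absurd hz hy
    · rintro rfl
      exact ⟨hx, .inl rfl⟩
  obtain ⟨h1, h2, h3⟩ := hY n U hU G s(x, y) (by simpa using hxy) (by rw [hfil]; simp)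
  exact ⟨h1, h2.trans h3⟩

/-- The central limit theorem for truncated neighbourhood sums: grouping the vertices by their ball
`U` of radius `k` gives semi-induced variables bounded by the indicator of connectedness of `U`. -/
theorem satisfiesCLT_truncatedNbhdSum {c : ℝ} {p : ℕ → unitInterval} {k : ℕ}
    {β : RootedGraph.IsoClass → ℝ}
    (hp : ∀ᶠ n : ℕ in atTop, (p n : ℝ) = c / (n : ℝ))
    (hβ : ∀ τ ∈ RootedGraph.radiusClasses k, 0 ≤ β τ ∧ β τ ≤ 1)
    (hvar : (fun n : ℕ => (n : ℝ) ^ ((2 : ℝ) / 3)) =o[atTop]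
        (fun n : ℕ => variance (fun G : SimpleGraph (Fin n) => truncatedNbhdSum c k β G)
          (SimpleGraph.binomialRandom (Fin n) (p n)))) :
    SatisfiesCLT p (fun n G => truncatedNbhdSum c k β G) := by
  set t := ⌊(10 * c * k) ^ (2 * k)⌋₊ with ht
  have hsum : ∀ (n : ℕ) (G : SimpleGraph (Fin n)), truncatedNbhdSum c k β G =
      ∑ U : Finset (Fin n) with U.card ≤ t, nbhdSumOn c k β U G := fun _ G =>
    truncatedNbhdSum_eq_sum_nbhdSumOn ht G
  simp only [hsum] at hvar ⊢
  refine satisfiesCLT_of_semiInduced (K := t) (t := t) (Nat.cast_nonneg _) (fun _ U hU => ?_)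
    (fun _ U _ => semiInduced_nbhdSumOn hβ U) (.of_forall fun _ U hU _ G =>
      ⟨nbhdSumOn_nonneg hβ U G, nbhdSumOn_le_connIndicator hβ ?_ G⟩) ?_ ?_
  · simpa using hU
  · have : U.card ≤ t := by simpa using hU
    exact_mod_cast this
  · refine IsBigO.of_bound |c| ?_
    filter_upwards [hp] with n hn
    rw [hn, div_eq_mul_one_div, norm_mul, Real.norm_eq_abs]
  · refine IsLittleO.of_bound fun ε hε => ?_
    filter_upwards [hvar.bound (show 0 < ε ^ 2 by positivity)] with n hn
    rw [Real.norm_of_nonneg (by positivity), Real.norm_of_nonneg (variance_nonneg _ _)] at hn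
    rw [Real.norm_of_nonneg (by positivity), Real.norm_of_nonneg (Real.sqrt_nonneg _)]
    have h1 : (n : ℝ) ^ ((1 : ℝ) / 3) = √((n : ℝ) ^ ((2 : ℝ) / 3)) := by
      rw [Real.sqrt_eq_rpow, ← Real.rpow_mul (Nat.cast_nonneg n)]
      norm_num
    rw [h1, ← Real.sqrt_sq hε.le, ← Real.sqrt_mul (sq_nonneg ε)]
    exact Real.sqrt_le_sqrt hn

theorem lemma3p7 :
    -- the central limit theorem for sums of semi-induced local random variables
    (∀ (p : ℕ → unitInterval) (K t : ℝ)
        (𝒰 : (n : ℕ) → Finset (Finset (Fin n)))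
        (Y : (n : ℕ) → Finset (Fin n) → SimpleGraph (Fin n) → ℝ),
      0 < K → 0 < t →
      (∀ n, ∀ U ∈ 𝒰 n, (U.card : ℝ) ≤ t) →
      (∀ n, ∀ U ∈ 𝒰 n, SemiInduced U (Y n U)) →
      (∀ n, ∀ U ∈ 𝒰 n, ∀ (G : SimpleGraph (Fin n)) (e : Sym2 (Fin n)),
        ¬ e.IsDiag → (U.filter (fun x => x ∈ e)).card = 1 →
          0 ≤ Y n U G ∧ Y n U G ≤ Y n U (G.deleteEdges {e}) ∧
            Y n U (G.deleteEdges {e}) ≤ connIndicator K U G) →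
      (fun n : ℕ => (p n : ℝ)) =Θ[atTop] (fun n : ℕ => 1 / (n : ℝ)) →
      (fun n : ℕ => (n : ℝ) ^ ((1 : ℝ) / 3)) =o[atTop]
        (fun n : ℕ => √(variance (fun G => ∑ U ∈ 𝒰 n, Y n U G)
          (SimpleGraph.binomialRandom (Fin n) (p n)))) →
      SatisfiesCLT p (fun n G => ∑ U ∈ 𝒰 n, Y n U G)) ∧
    -- the central limit theorem for truncated weighted neighbourhood sums
    (∀ (c : ℝ) (p : ℕ → unitInterval) (k : ℕ) (β : RootedGraph.IsoClass → ℝ),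
      1 < c →
      (∀ᶠ n : ℕ in atTop, (p n : ℝ) = c / (n : ℝ)) →
      (∀ τ ∈ RootedGraph.radiusClasses k, 0 ≤ β τ ∧ β τ ≤ 1) →
      (fun n : ℕ => (n : ℝ) ^ ((2 : ℝ) / 3)) =o[atTop]
        (fun n : ℕ => variance (fun G : SimpleGraph (Fin n) => truncatedNbhdSum c k β G)
          (SimpleGraph.binomialRandom (Fin n) (p n))) →
      SatisfiesCLT p (fun n G => truncatedNbhdSum c k β G)) := by
  refine ⟨fun p K t 𝒰 Y hK _ hcard hsemi hY hp hσ =>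
    satisfiesCLT_of_semiInduced_of_deleteEdges hK hcard hsemi hY hp.1 hσ,
    fun c p k β _ hp hβ hvar => satisfiesCLT_truncatedNbhdSum hp hβ hvar⟩
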